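/- **Setting.** Consider $N\ge 1$ control areas $1,\dots,N$ joined by tie-lines $e=1,\dots,m$, each with an arbitrarily chosen direction, which form a connected undirected graph without self-loops. Let $F\in\mathbb R^{N\times m}$ be the oriented incidence matrix, $\tilde F$ the matrix $F$ without its last row, and $B_l=\mathrm{diag}(B_e)$ with $B_e>0$. For each area $i$ let $M_i,D_i,a_i,b_i,\beta_i>0$, $\underline w_i<0<\overline w_i$, let $[\underline P_i,\overline P_i]$ be the generation limits and $d_i$ the (constant) net load. Assume $\underline P_i<d_i<\overline P_i$ for all $i$. The state is $z=(\alpha,w,P^r,\xi)\in\mathcal Z:=\mathbb R^{N-1}\times\mathbb R^N\times\prod_i[\underline P_i,\overline P_i]\times\mathbb R^N$. Put $\varphi(\alpha)=FB_l\tilde F^{\top}\alpha$ and $$\tilde l_i(z)=D_iw_i+d_i+\varphi_i(\alpha)+\beta_iM_i(\underline w_i-w_i),\qquad \tilde u_i(z)=D_iw_i+d_i+\varphi_i(\alpha)-\beta_iM_i(w_i-\overline w_i),$$ $$P_{g,i}(z)=\min\bigl\{\max\{P^r_i,\max\{\underline P_i,\tilde l_i(z)\}\},\min\{\overline P_i,\tilde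 u_i(z)\}\bigr\}.$$ The closed-loop projected system is $$\dot\alpha_k=w_k-w_N\ (k<N),\qquad M_i\dot w_i=-D_iw_i+P_{g,i}(z)-d_i-\varphi_i(\alpha),$$ $$\dot P^r_i=\bigl[-a_iP^r_i-b_i-\xi_i-w_i\bigr]_{P^r_i-\underline P_i}^{\overline P_i-P^r_i},\qquad \dot\xi_i=P^r_i-d_i ,$$ where $[u]_{x-\underline x}^{\overline x-x}$ is $0$ if ($x=\underline x$ and $u\le0$) or ($x=\overline x$ and $u\ge0$), and $u$ otherwise. A solution on $[0,T)$, $0<T\le\infty$, is a locally absolutely continuous $z:[0,T)\to\mathcal Z$ that satisfies these equations for almost every $t$; it is maximal if it has no extension to a solution on a longer interval, and complete if $T=\infty$. An equilibrium is a point of $\mathcal Z$ at which the right-hand side vanishes. The safety quadratic program of area $i$ in the state $z$ is to minimise $\tfrac12(P-P^r_i)^2$ over $P$ subject to $\underline P_i\le P\le\overline P_i$ and $\tilde l_i(z)\le P\le\tilde u_i(z)$. **Theorem (stability).** The closed-loop system has exactly one equilibrium $z_e$, and 1. $z_e$ is asymptotically stable: for every neighbourhood $U$ of $z_e$ there is a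 neighbourhood $V$ of $z_e$ such that every solution with $z(0)\in V$ stays in $U$ on its whole interval of existence; and there is a neighbourhood $V$ of $z_e$ such that every maximal solution with $z(0)\in V$ is complete and converges to $z_e$ as $t\to\infty$; 2. every maximal solution along which the safety quadratic programs of all areas are feasible at all times of its interval of existence is complete and converges to $z_e$ as $t\to\infty$. -/

import Mathlib

open Set Filter Topology MeasureTheory

noncomputable section

/-- The data of a multi-area power network with `N = n + 1` control areas (the last one being the
angle reference) and `m` directed tie-lines, together with the controller parameters and the net
loads.  The direction of a tie-line is arbitrary.  -/
structure PowerSystem (n m : ℕ) where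
  /-- start and end area of each tie-line -/
  src : Fin m → Fin (n + 1)
  tgt : Fin m → Fin (n + 1)
  src_ne_tgt : ∀ e, src e ≠ tgt e
  /-- the undirected graph of areas and tie-lines is connected -/
  connected : (SimpleGraph.fromRel fun i j => ∃ e, src e = i ∧ tgt e = j).Connected
  /-- tie-line sensitivities -/
  B : Fin m → ℝ
  B_pos : ∀ e, 0 < B e
  /-- inertia and damping of each area -/
  M : Fin (n + 1) → ℝ
  M_pos : ∀ i, 0 < M i
  D : Fin (n + 1) → ℝ
  D_pos : ∀ i, 0 < D i
  /-- net loads -/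
  d : Fin (n + 1) → ℝ
  /-- quadratic and linear generation cost coefficients -/
  a : Fin (n + 1) → ℝ
  a_pos : ∀ i, 0 < a i
  b : Fin (n + 1) → ℝ
  b_pos : ∀ i, 0 < b i
  /-- barrier parameters -/
  β : Fin (n + 1) → ℝ
  β_pos : ∀ i, 0 < β i
  /-- bounds of the safe frequency deviation -/
  wmin : Fin (n + 1) → ℝ
  wmin_neg : ∀ i, wmin i < 0
  wmax : Fin (n + 1) → ℝ
  wmax_pos : ∀ i, 0 < wmax i
  /-- generation capacity limits -/
  Pmin : Fin (n + 1) → ℝ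
  Pmax : Fin (n + 1) → ℝ

/-- The state `z = (α, w, Pʳ, ξ)`: reduced angles, frequencies, generation references and
multipliers. -/
abbrev PowerState (n : ℕ) : Type :=
  (Fin n → ℝ) × (Fin (n + 1) → ℝ) × (Fin (n + 1) → ℝ) × (Fin (n + 1) → ℝ)

/-- The scalar projection operator `[u]` at `x ∈ [lo, hi]`: it is `0` when `u` points out of the
interval (or vanishes) at an end point, and `u` otherwise. -/
def projBox (lo hi x u : ℝ) : ℝ :=
  open Classical in if (x - lo = 0 ∧ u ≤ 0) ∨ (hi - x = 0 ∧ 0 ≤ u) then 0 else u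

namespace PowerState

variable {n : ℕ}

def angle (z : PowerState n) : Fin n → ℝ := z.1
def freq (z : PowerState n) : Fin (n + 1) → ℝ := z.2.1
def genRef (z : PowerState n) : Fin (n + 1) → ℝ := z.2.2.1
def mult (z : PowerState n) : Fin (n + 1) → ℝ := z.2.2.2

end PowerState

namespace PowerSystem

variable {n m : ℕ} (S : PowerSystem n m)

/-- The oriented incidence matrix `F`. -/
def incidence : Matrix (Fin (n + 1)) (Fin m) ℝ :=
  Matrix.of fun i e => if i = S.src e then 1 else if i = S.tgt e then -1 else 0

/-- The reduced incidence matrix: `F` without its last row. -/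
def reducedIncidence : Matrix (Fin n) (Fin m) ℝ :=
  S.incidence.submatrix Fin.castSucc id

/-- The net tie-line powers, `F * diag B * (reduced F)ᵀ * α`. -/
def tiePower (α : Fin n → ℝ) : Fin (n + 1) → ℝ :=
  (S.incidence * Matrix.diagonal S.B * S.reducedIncidence.transpose).mulVec α

/-- The lower bound on the generation of area `i` from the control barrier condition. -/
def barrierLower (z : PowerState n) (i : Fin (n + 1)) : ℝ :=
  S.D i * z.freq i + S.d i + S.tiePower z.angle i + S.β i * S.M i * (S.wmin i - z.freq i)

/-- The upper bound on the generation of area `i` from the control barrier condition. -/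
def barrierUpper (z : PowerState n) (i : Fin (n + 1)) : ℝ :=
  S.D i * z.freq i + S.d i + S.tiePower z.angle i - S.β i * S.M i * (z.freq i - S.wmax i)

/-- In the state `z`, the safety quadratic program of every area, i.e. to minimise
`(P - Pʳ i)² / 2` over the `P` within the capacity limits and the barrier bounds, has a
feasible point. -/
def SafetyFeasible (z : PowerState n) : Prop :=
  ∀ i, ∃ P : ℝ, (S.Pmin i ≤ P ∧ P ≤ S.Pmax i) ∧ S.barrierLower z i ≤ P ∧ P ≤ S.barrierUpper z i

/-- The corrected generation `P_g(z) = min (max Pʳ l_b) u_b`. -/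
def generation (z : PowerState n) (i : Fin (n + 1)) : ℝ :=
  min (max (z.genRef i) (max (S.Pmin i) (S.barrierLower z i)))
    (min (S.Pmax i) (S.barrierUpper z i))

/-- The right-hand side of the closed-loop projected system. -/
def closedLoop (z : PowerState n) : PowerState n :=
  (fun k => z.freq k.castSucc - z.freq (Fin.last n),
   fun i => (S.M i)⁻¹ *
     (-(S.D i * z.freq i) + S.generation z i - S.d i - S.tiePower z.angle i),
   fun i => projBox (S.Pmin i) (S.Pmax i) (z.genRef i)
     (-(S.a i * z.genRef i) - S.b i - z.mult i - z.freq i),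
   fun i => z.genRef i - S.d i)

/-- The state set: only the generation references are constrained. -/
def stateSet : Set (PowerState n) :=
  {z | ∀ i, S.Pmin i ≤ z.genRef i ∧ z.genRef i ≤ S.Pmax i}

def IsEquilibrium (z : PowerState n) : Prop :=
  z ∈ S.stateSet ∧ S.closedLoop z = 0

/-- `z` is a Carathéodory solution of the closed-loop system on `[0, T)`, where `0 < T ≤ ∞`:
(locally) absolutely continuous, with values in the state set, and satisfying the differential
equation almost everywhere.  Values of `z` outside `[0, T)` are irrelevant. -/
structure IsSolution (T : EReal) (z : ℝ → PowerState n) : Prop where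
  pos : 0 < T
  absCont : ∀ c : ℝ, 0 ≤ c → (c : EReal) < T → AbsolutelyContinuousOnInterval z 0 c
  mem : ∀ t : ℝ, 0 ≤ t → (t : EReal) < T → z t ∈ S.stateSet
  deriv : ∀ᵐ t : ℝ, 0 ≤ t → (t : EReal) < T → HasDerivAt z (S.closedLoop (z t)) t

/-- A solution on `[0, T)` that has no extension to a solution on a longer interval. -/
def IsMaximalSolution (T : EReal) (z : ℝ → PowerState n) : Prop :=
  S.IsSolution T z ∧
    ∀ (T' : EReal) (z' : ℝ → PowerState n), S.IsSolution T' z' → T ≤ T' →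
      (∀ t : ℝ, 0 ≤ t → (t : EReal) < T → z' t = z t) → T' = T

/-- Lyapunov stability. -/
def IsStable (ze : PowerState n) : Prop :=
  ∀ U ∈ 𝓝 ze, ∃ V ∈ 𝓝 ze, ∀ (T : EReal) (z : ℝ → PowerState n),
    S.IsSolution T z → z 0 ∈ V → ∀ t : ℝ, 0 ≤ t → (t : EReal) < T → z t ∈ U

/-- Local attractivity: maximal solutions that start close to `ze` are complete and converge
to `ze`. -/
def IsAttractive (ze : PowerState n) : Prop :=
  ∃ V ∈ 𝓝 ze, ∀ (T : EReal) (z : ℝ → PowerState n),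
    S.IsMaximalSolution T z → z 0 ∈ V → T = ⊤ ∧ Tendsto z atTop (𝓝 ze)

def IsAsymptoticallyStable (ze : PowerState n) : Prop :=
  S.IsStable ze ∧ S.IsAttractive ze

end PowerSystem

end

/-! ### Absolutely continuous functions on intervals -/

/-! Write ω for the frequency rate, q for the projected rate of the generation reference, and c for
the correction, i.e. generation minus reference.

At an equilibrium all frequencies agree. Summing the power balances cancels the tie-line flows, and
the clipping by the safety program opposes the common frequency, which must therefore vanish.
Connectedness then kills the angles, and the loads lie strictly inside the capacity limits, so the
projection is inactive and fixes the multipliers (`isEquilibrium_iff`).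

The energy of the deviation decays at least at the rate of the damping and cost terms, except for
the exchange term Σ w c (`exists_hasDerivAt_energy`). Near the equilibrium c = 0, which gives
stability. Far from it w c has no sign, and the energy alone does not suffice. The remedy is to add
an energy of the velocity. While c ≠ 0 in a feasible state, one barrier condition is an equality, so
w relaxes linearly to a frequency bound and ω' = -β ω (`mul_correction_eq_of_hasDerivAt`).
Subtracting ω c from the velocity energy hence turns its exchange term into β ω c. With a weight g ≤
β² on the first energy, g w c + β ω c is nonpositive up to the violation of the frequency bounds
(`correction_spec`). That violation decays like exp(-β t) by the barrier conditions
(`IsSolution.freq_bounds`) and is absorbed by an explicit exponential term.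

The velocity energy also needs q²/2, and q jumps when a capacity limit becomes active. Its decay is
obtained from difference quotients and the monotonicity of the projection
(`projBox_speed_sq_sub_le`). The resulting functional (`IsSolution.exists_lyapunov`) bounds the
solution and makes the dissipation integrable. Repeated use of Barbalat's lemma then yields
convergence (`IsSolution.tendsto_equilibrium`).

Completeness needs continuation, hence local existence for a discontinuous field: the references are
produced by reflecting an unconstrained path at its barrier, which turns the problem into a fixed
point equation for a contraction (`exists_local_solution`). Feasibility rules out blow-up in finite
time (`IsSolution.exists_norm_le_of_feasible`). -/

theorem LipschitzWith.comp_absolutelyContinuousOnInterval {X Y : Type*} [PseudoMetricSpace X]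
    [PseudoMetricSpace Y] {K : NNReal} {g : X → Y} (hg : LipschitzWith K g) {f : ℝ → X} {a b : ℝ}
    (hf : AbsolutelyContinuousOnInterval f a b) :
    AbsolutelyContinuousOnInterval (fun t => g (f t)) a b := by
  unfold AbsolutelyContinuousOnInterval at hf ⊢
  have h2 := hf.const_mul (K : ℝ)
  rw [mul_zero] at h2
  refine squeeze_zero (fun E => Finset.sum_nonneg fun _ _ => dist_nonneg) (fun E => ?_) h2
  rw [Finset.mul_sum]
  exact Finset.sum_le_sum fun i _ => hg.dist_le_mul _ _

theorem AbsolutelyContinuousOnInterval.fun_sum {ι : Type*} (s : Finset ι) {f : ι → ℝ → ℝ} {a b : ℝ}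
    (hf : ∀ i ∈ s, AbsolutelyContinuousOnInterval (f i) a b) :
    AbsolutelyContinuousOnInterval (fun t => ∑ i ∈ s, f i t) a b := by
  classical
  induction s using Finset.induction_on with
  | empty =>
    simp only [Finset.sum_empty]
    exact (LipschitzWith.const (0 : ℝ)).lipschitzOnWith.absolutelyContinuousOnInterval
  | insert i s hi ih =>
    simp only [Finset.sum_insert hi]
    exact (hf i (Finset.mem_insert_self i s)).add
      (ih fun j hj => hf j (Finset.mem_insert_of_mem hj))

theorem AbsolutelyContinuousOnInterval.of_const (c a b : ℝ) :
    AbsolutelyContinuousOnInterval (fun _ : ℝ => c) a b :=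
  (LipschitzWith.const c).lipschitzOnWith.absolutelyContinuousOnInterval

theorem AbsolutelyContinuousOnInterval.mono_Icc {X : Type*} [PseudoMetricSpace X] {f : ℝ → X}
    {a b c d : ℝ} (hf : AbsolutelyContinuousOnInterval f a b) (hac : a ≤ c) (hcd : c ≤ d)
    (hdb : d ≤ b) : AbsolutelyContinuousOnInterval f c d := by
  refine hf.mono ?_
  rw [uIcc_of_le hcd, uIcc_of_le (hac.trans (hcd.trans hdb))]
  exact Icc_subset_Icc hac hdb

theorem ae_restrict_Icc_of_ae_Ioo {P : ℝ → Prop} {a b : ℝ}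
    (h : ∀ᵐ t : ℝ, t ∈ Ioo a b → P t) : ∀ᵐ t ∂(volume.restrict (Icc a b)), P t := by
  rw [← restrict_Ioo_eq_restrict_Icc]
  exact (ae_restrict_iff' measurableSet_Ioo).2 h

/-- Integrating an almost everywhere bound on the derivative of an absolutely continuous
function. -/
theorem AbsolutelyContinuousOnInterval.sub_le_integral {f g : ℝ → ℝ} {a b : ℝ} (hab : a ≤ b)
    (hf : AbsolutelyContinuousOnInterval f a b) (hg : IntervalIntegrable g volume a b)
    (h : ∀ᵐ t : ℝ, t ∈ Ioo a b → ∃ f', HasDerivAt f f' t ∧ f' ≤ g t) :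
    f b - f a ≤ ∫ t in a..b, g t := by
  rw [← hf.integral_deriv_eq_sub]
  refine intervalIntegral.integral_mono_ae_restrict hab hf.intervalIntegrable_deriv hg ?_
  refine ae_restrict_Icc_of_ae_Ioo ?_
  filter_upwards [h] with t ht hmem
  obtain ⟨f', h1, h2⟩ := ht hmem
  rwa [h1.deriv]

theorem AbsolutelyContinuousOnInterval.sub_le_mul {f : ℝ → ℝ} {a b C : ℝ} (hab : a ≤ b)
    (hf : AbsolutelyContinuousOnInterval f a b)
    (h : ∀ᵐ t : ℝ, t ∈ Ioo a b → ∃ f', HasDerivAt f f' t ∧ f' ≤ C) :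
    f b - f a ≤ C * (b - a) := by
  have := hf.sub_le_integral hab (g := fun _ => C) (by simp) h
  simpa [mul_comm] using this

theorem AbsolutelyContinuousOnInterval.le_of_deriv_nonpos {f : ℝ → ℝ} {a b : ℝ} (hab : a ≤ b)
    (hf : AbsolutelyContinuousOnInterval f a b)
    (h : ∀ᵐ t : ℝ, t ∈ Ioo a b → ∃ f', HasDerivAt f f' t ∧ f' ≤ 0) : f b ≤ f a := by
  have := hf.sub_le_mul hab h
  linarith

theorem AbsolutelyContinuousOnInterval.abs_sub_le_mul {f : ℝ → ℝ} {a b C : ℝ} (hab : a ≤ b)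
    (hf : AbsolutelyContinuousOnInterval f a b)
    (h : ∀ᵐ t : ℝ, t ∈ Ioo a b → ∃ f', HasDerivAt f f' t ∧ |f'| ≤ C) :
    |f b - f a| ≤ C * (b - a) := by
  rw [abs_sub_le_iff]
  constructor
  · refine hf.sub_le_mul hab ?_
    filter_upwards [h] with t ht hm
    obtain ⟨f', h1, h2⟩ := ht hm
    exact ⟨f', h1, (abs_le.1 h2).2⟩
  · have := hf.neg.sub_le_mul hab (C := C) ?_
    · simp only [Pi.neg_apply] at this
      linarith
    filter_upwards [h] with t ht hm
    obtain ⟨f', h1, h2⟩ := ht hm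
    exact ⟨-f', h1.neg, by linarith [(abs_le.1 h2).1]⟩

/-- **Barbalat's lemma** for absolutely continuous functions. -/
theorem tendsto_zero_of_uniformContinuous_deriv {F y : ℝ → ℝ} {s l : ℝ}
    (hF : ∀ a b, s ≤ a → a ≤ b → AbsolutelyContinuousOnInterval F a b)
    (hd : ∀ᵐ t : ℝ, s < t → HasDerivAt F (y t) t)
    (hy : UniformContinuousOn y (Ici s)) (hl : Tendsto F atTop (𝓝 l)) :
    Tendsto y atTop (𝓝 0) := by
  rw [Metric.tendsto_atTop]
  intro ε hε
  obtain ⟨δ, hδ, hyδ⟩ := Metric.uniformContinuousOn_iff.1 hy (ε / 2) (by positivity)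
  obtain ⟨N, hN⟩ := Metric.tendsto_atTop.1 hl (ε * δ / 8) (by positivity)
  refine ⟨max N s, fun t ht => ?_⟩
  have hts : s ≤ t := (le_max_right _ _).trans ht
  have htN : N ≤ t := (le_max_left _ _).trans ht
  have h1 := hN t htN
  have h2 := hN (t + δ / 2) (by linarith)
  rw [Real.dist_eq] at h1 h2
  -- On a window of length δ/2 the function `F` is within εδ/4 of being affine with slope `y t`.
  -- Since `F` moves by less than εδ/4 there, |`y t`| < ε.
  have key : |(F (t + δ / 2) - y t * (t + δ / 2)) - (F t - y t * t)| ≤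
      ε / 2 * (t + δ / 2 - t) := by
    have hAC : AbsolutelyContinuousOnInterval (F - fun τ => y t * τ) t (t + δ / 2) :=
      (hF t (t + δ / 2) hts (by linarith)).sub
        (LipschitzWith.id.lipschitzOnWith.absolutelyContinuousOnInterval.const_mul (y t))
    refine hAC.abs_sub_le_mul (by linarith) ?_
    filter_upwards [hd] with τ hτ hm
    refine ⟨y τ - y t * 1, (hτ (hts.trans_lt hm.1)).sub ((hasDerivAt_id τ).const_mul _), ?_⟩
    have := hyδ τ (hts.trans hm.1.le) t hts (by
      rw [Real.dist_eq, abs_lt]; constructor <;> linarith [hm.1, hm.2])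
    rw [Real.dist_eq] at this
    simpa using this.le
  rw [Real.dist_eq, sub_zero]
  rw [abs_le] at key
  rw [abs_lt] at h1 h2 ⊢
  constructor <;> nlinarith

theorem LipschitzOnWith.comp_add_const {X : Type*} [PseudoMetricSpace X] {p : ℝ → X} {K : NNReal}
    {a b h : ℝ} (hp : LipschitzOnWith K p (Icc (a + h) (b + h))) :
    LipschitzOnWith K (fun τ => p (τ + h)) (Icc a b) := by
  refine LipschitzOnWith.of_dist_le_mul fun x hx y hy => ?_
  have := hp.dist_le_mul (x + h) ⟨by linarith [hx.1], by linarith [hx.2]⟩ (y + h)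
    ⟨by linarith [hy.1], by linarith [hy.2]⟩
  rwa [dist_add_right] at this

theorem ae_comp_add_const {P : ℝ → Prop} (h : ∀ᵐ t : ℝ, P t) (c : ℝ) : ∀ᵐ t : ℝ, P (t + c) :=
  (measurePreserving_add_right volume c).quasiMeasurePreserving.ae h

/-! ### The scalar projection operator -/

theorem abs_projBox_le (lo hi x u : ℝ) : |projBox lo hi x u| ≤ |u| := by
  unfold projBox
  split_ifs <;> simp

/-- The drive `u` is suppressed only when it does not point into the interval, and then `(x - x') *
u` is nonnegative for every admissible `x'`. -/
theorem sub_mul_projBox_le {lo hi x x' : ℝ} (hx' : lo ≤ x' ∧ x' ≤ hi) (u : ℝ) :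
    (x - x') * projBox lo hi x u ≤ (x - x') * u := by
  unfold projBox
  split_ifs with h
  · rcases h with ⟨h1, h2⟩ | ⟨h1, h2⟩ <;> nlinarith
  · exact le_rfl

theorem projBox_of_mem_Ioo {lo hi x : ℝ} (h1 : lo < x) (h2 : x < hi) (u : ℝ) :
    projBox lo hi x u = u := by
  unfold projBox
  rw [if_neg]
  rintro (⟨h, _⟩ | ⟨h, _⟩) <;> linarith

/-- Each point serves as the test point of the variational inequality at the other. This
monotonicity lets two times of one trajectory be compared without knowing when the projection is
active. -/
theorem sub_mul_projBox_sub_le {lo hi x x' : ℝ} (hx : lo ≤ x ∧ x ≤ hi) (hx' : lo ≤ x' ∧ x' ≤ hi)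
    (u u' : ℝ) :
    (x - x') * (projBox lo hi x u - projBox lo hi x' u') ≤ (x - x') * (u - u') := by
  have h1 := sub_mul_projBox_le (x := x) hx' u
  have h2 := sub_mul_projBox_le (x := x') hx u'
  linarith

/-- The decay of the squared speed of a scalar projected gradient flow with a Lipschitz input. -/
theorem projBox_speed_sq_sub_le {p q y v : ℝ → ℝ} {lo hi a s t : ℝ} {K K' : NNReal} (hst : s ≤ t)
    (hp : LipschitzOnWith K p (Icc s (t + 1))) (hy : LipschitzOnWith K' y (Icc s (t + 1)))
    (hmem : ∀ τ ∈ Icc s (t + 1), lo ≤ p τ ∧ p τ ≤ hi)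
    (hq : ∀ τ, q τ = projBox lo hi (p τ) (-(a * p τ) - y τ))
    (hpd : ∀ᵐ τ : ℝ, τ ∈ Ioo s (t + 1) → HasDerivAt p (q τ) τ)
    (hyd : ∀ᵐ τ : ℝ, τ ∈ Ioo s (t + 1) → HasDerivAt y (v τ) τ)
    (hps : HasDerivAt p (q s) s) (hpt : HasDerivAt p (q t) t) :
    q t ^ 2 / 2 - q s ^ 2 / 2 ≤ ∫ τ in s..t, q τ * (-(a * q τ) - v τ) := by
  -- The speed `q` may jump, so `q ^ 2` is not differentiated. The difference quotients `P k` of `p`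
  -- are Lipschitz, satisfy the inequality for each step `h k`, and converge to `q` wherever `p` is
  -- differentiable; at `s` and `t` this is assumed.
  set h : ℕ → ℝ := fun k => 1 / ((k : ℝ) + 1) with hh
  have hpos : ∀ k, 0 < h k := fun k => by positivity
  have hle : ∀ k, h k ≤ 1 := fun k => by
    rw [hh]; simp only; rw [div_le_one (by positivity)]; linarith [k.cast_nonneg (α := ℝ)]
  have hlim : Tendsto h atTop (𝓝[≠] 0) := by
    refine tendsto_nhdsWithin_iff.2 ⟨tendsto_one_div_add_atTop_nhds_zero_nat, ?_⟩
    exact Eventually.of_forall fun k => (hpos k).ne'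
  set P : ℕ → ℝ → ℝ := fun k τ => (h k)⁻¹ * (p (τ + h k) - p τ) with hP
  set Y : ℕ → ℝ → ℝ := fun k τ => (h k)⁻¹ * (y (τ + h k) - y τ) with hY
  have hPlim : ∀ τ q', HasDerivAt p q' τ → Tendsto (fun k => P k τ) atTop (𝓝 q') := by
    intro τ q' hd
    exact (hasDerivAt_iff_tendsto_slope_zero.1 hd).comp hlim
  have hYlim : ∀ τ q', HasDerivAt y q' τ → Tendsto (fun k => Y k τ) atTop (𝓝 q') := by
    intro τ q' hd
    exact (hasDerivAt_iff_tendsto_slope_zero.1 hd).comp hlim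
  have hsub : ∀ k, Icc (s + h k) (t + h k) ⊆ Icc s (t + 1) := fun k =>
    Icc_subset_Icc (by linarith [hpos k]) (by linarith [hle k])
  have hsub' : Icc s t ⊆ Icc s (t + 1) := Icc_subset_Icc le_rfl (by linarith)
  have hbd : ∀ {C : NNReal} {g : ℝ → ℝ}, LipschitzOnWith C g (Icc s (t + 1)) → ∀ k, ∀ τ ∈ Icc s t,
      |(h k)⁻¹ * (g (τ + h k) - g τ)| ≤ C := by
    intro C g hg k τ hτ
    have := hg.dist_le_mul (τ + h k) ⟨by linarith [hτ.1, hpos k], by linarith [hτ.2, hle k]⟩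
      τ (hsub' hτ)
    rw [Real.dist_eq, Real.dist_eq, add_sub_cancel_left, abs_of_pos (hpos k)] at this
    rw [abs_mul, abs_of_pos (inv_pos.2 (hpos k)), inv_mul_le_iff₀ (hpos k)]
    linarith
  have hPac : ∀ k, AbsolutelyContinuousOnInterval (P k) s t := by
    intro k
    refine AbsolutelyContinuousOnInterval.const_mul _ (AbsolutelyContinuousOnInterval.sub ?_ ?_)
    · refine LipschitzOnWith.absolutelyContinuousOnInterval (K := K) ?_
      rw [uIcc_of_le hst]
      exact LipschitzOnWith.comp_add_const (hp.mono (hsub k))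
    · refine LipschitzOnWith.absolutelyContinuousOnInterval (K := K) ?_
      rw [uIcc_of_le hst]
      exact hp.mono hsub'
  have hYac : ∀ k, AbsolutelyContinuousOnInterval (Y k) s t := by
    intro k
    refine AbsolutelyContinuousOnInterval.const_mul _ (AbsolutelyContinuousOnInterval.sub ?_ ?_)
    · refine LipschitzOnWith.absolutelyContinuousOnInterval (K := K') ?_
      rw [uIcc_of_le hst]
      exact LipschitzOnWith.comp_add_const (hy.mono (hsub k))
    · refine LipschitzOnWith.absolutelyContinuousOnInterval (K := K') ?_
      rw [uIcc_of_le hst]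
      exact hy.mono hsub'
  have hcont : ∀ k, ContinuousOn (fun τ => P k τ * (-(a * P k τ) - Y k τ)) (uIcc s t) := fun k =>
    (hPac k).continuousOn.mul
      (((hPac k).continuousOn.const_smul a).neg.sub (hYac k).continuousOn)
  have hineq : ∀ k, P k t ^ 2 / 2 - P k s ^ 2 / 2 ≤
      ∫ τ in s..t, P k τ * (-(a * P k τ) - Y k τ) := by
    intro k
    have hac : AbsolutelyContinuousOnInterval (fun τ => P k τ ^ 2 / 2) s t := by
      have := (((hPac k).mul (hPac k)).const_mul (1 / 2))
      refine (congrArg (fun f => AbsolutelyContinuousOnInterval f s t) (funext fun τ => ?_)).mp this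
      simp only [Pi.mul_apply]; ring
    refine hac.sub_le_integral hst (hcont k).intervalIntegrable ?_
    filter_upwards [hpd, ae_comp_add_const hpd (h k)] with τ h1 h2 hτ
    have e1 := h1 ⟨hτ.1, by linarith [hτ.2]⟩
    have e2 := h2 ⟨by linarith [hτ.1, hpos k], by linarith [hτ.2, hle k]⟩
    have e3 : HasDerivAt (P k) ((h k)⁻¹ * (q (τ + h k) - q τ)) τ :=
      ((e2.comp_add_const τ (h k)).sub e1).const_mul _
    refine ⟨_, (e3.pow 2).div_const 2, ?_⟩
    have hm1 := hmem (τ + h k) ⟨by linarith [hτ.1, hpos k], by linarith [hτ.2, hle k]⟩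
    have hm2 := hmem τ ⟨hτ.1.le, by linarith [hτ.2]⟩
    have := sub_mul_projBox_sub_le hm1 hm2 (-(a * p (τ + h k)) - y (τ + h k)) (-(a * p τ) - y τ)
    rw [← hq, ← hq] at this
    have hi2 : 0 ≤ (h k)⁻¹ * (h k)⁻¹ := by have := hpos k; positivity
    have h3 := mul_le_mul_of_nonneg_left this hi2
    simp only [hP, hY]
    norm_num
    nlinarith [h3]
  have hae : ∀ᵐ τ ∂(volume : Measure ℝ), τ ∈ Ioo s t →
      HasDerivAt p (q τ) τ ∧ HasDerivAt y (v τ) τ := by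
    filter_upwards [hpd, hyd] with τ h1 h2 hτ
    exact ⟨h1 ⟨hτ.1, by linarith [hτ.2]⟩, h2 ⟨hτ.1, by linarith [hτ.2]⟩⟩
  -- The Lipschitz constants of `p` and `y` bound all quotients, which supplies the dominating
  -- constant.
  have hIlim : Tendsto (fun k => ∫ τ in s..t, P k τ * (-(a * P k τ) - Y k τ)) atTop
      (𝓝 (∫ τ in s..t, q τ * (-(a * q τ) - v τ))) := by
    refine intervalIntegral.tendsto_integral_filter_of_dominated_convergence
      (fun _ => K * (|a| * K + K')) ?_ ?_ (by simp) ?_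
    · rw [uIoc_of_le hst]
      exact Eventually.of_forall fun k =>
        ((hcont k).intervalIntegrable (μ := volume)).1.aestronglyMeasurable
    · refine Eventually.of_forall fun k => Eventually.of_forall fun τ hτ => ?_
      rw [uIoc_of_le hst] at hτ
      have b1 : |P k τ| ≤ K := hbd hp k τ ⟨hτ.1.le, hτ.2⟩
      have b2 : |Y k τ| ≤ K' := hbd hy k τ ⟨hτ.1.le, hτ.2⟩
      rw [Real.norm_eq_abs, abs_mul]
      refine mul_le_mul b1 ?_ (abs_nonneg _) K.2
      refine (abs_sub _ _).trans (add_le_add ?_ b2)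
      rw [abs_neg, abs_mul]
      exact mul_le_mul_of_nonneg_left b1 (abs_nonneg _)
    · have hne : ∀ᵐ τ : ℝ, τ ≠ t := by simp [ae_iff]
      filter_upwards [hae, hne] with τ h1 h2 hτ
      rw [uIoc_of_le hst] at hτ
      obtain ⟨d1, d2⟩ := h1 ⟨hτ.1, lt_of_le_of_ne hτ.2 h2⟩
      exact (hPlim _ _ d1).mul (((hPlim _ _ d1).const_mul a).neg.sub (hYlim _ _ d2))
  refine le_of_tendsto_of_tendsto ?_ hIlim (Eventually.of_forall hineq)
  exact (((hPlim _ _ hpt).pow 2).div_const 2).sub (((hPlim _ _ hps).pow 2).div_const 2)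

noncomputable section

/-! ### One-sided reflection of a path -/

/-- The running maximum of the positive part of `g` on `[0, t]`. -/
def runMax (g : ℝ → ℝ) (t : ℝ) : ℝ := sSup ((fun r => max 0 (g (r * t))) '' Icc 0 1)

theorem le_runMax {g : ℝ → ℝ} (hg : Continuous g) {s t : ℝ} (hs : 0 ≤ s) (hst : s ≤ t) :
    max 0 (g s) ≤ runMax g t := by
  have hc : Continuous fun r : ℝ => max 0 (g (r * t)) := by fun_prop
  refine le_csSup (isCompact_Icc.image hc).bddAbove ?_
  rcases hst.eq_or_lt with rfl | h
  · exact ⟨1, by simp, by simp⟩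
  · have ht : 0 < t := hs.trans_lt h
    refine ⟨s / t, ⟨by positivity, (div_le_one ht).2 hst⟩, ?_⟩
    simp only
    rw [div_mul_cancel₀ _ ht.ne']

theorem exists_runMax_eq {g : ℝ → ℝ} (hg : Continuous g) {t : ℝ} (ht : 0 ≤ t) :
    ∃ s, 0 ≤ s ∧ s ≤ t ∧ runMax g t = max 0 (g s) := by
  have hc : Continuous fun r : ℝ => max 0 (g (r * t)) := by fun_prop
  obtain ⟨r, hr, h⟩ := (isCompact_Icc.image hc).sSup_mem
    (Set.Nonempty.image _ (nonempty_Icc.2 zero_le_one))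
  exact ⟨r * t, mul_nonneg hr.1 ht, mul_le_of_le_one_left ht hr.2, h.symm⟩

theorem continuous_runMax {g : ℝ → ℝ} (hg : Continuous g) : Continuous (runMax g) := by
  -- Rescaling time by `r` in [0, 1] makes this a supremum over a compact set independent of `t`.
  refine isCompact_Icc.continuous_sSup (f := fun t r : ℝ => max 0 (g (r * t))) ?_
  have : Continuous fun x : ℝ × ℝ => max 0 (g (x.2 * x.1)) := by fun_prop
  exact this

theorem runMax_sub_le {g g' : ℝ → ℝ} (hg : Continuous g) (hg' : Continuous g') {t C : ℝ}
    (ht : 0 ≤ t) (h : ∀ s, 0 ≤ s → s ≤ t → |g s - g' s| ≤ C) :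
    runMax g t - runMax g' t ≤ C := by
  obtain ⟨s, hs, hst, e⟩ := exists_runMax_eq hg ht
  have h1 := le_runMax hg' hs hst
  have h2 := (abs_le.1 (h s hs hst)).2
  have h3 := le_max_left 0 (g' s)
  have h4 := le_max_right 0 (g' s)
  have h5 := (abs_nonneg _).trans (h s hs hst)
  have h6 : max 0 (g s) ≤ runMax g' t + C := max_le (by linarith) (by linarith)
  linarith

theorem abs_runMax_sub_le {g g' : ℝ → ℝ} (hg : Continuous g) (hg' : Continuous g') {t C : ℝ}
    (ht : 0 ≤ t) (h : ∀ s, 0 ≤ s → s ≤ t → |g s - g' s| ≤ C) :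
    |runMax g t - runMax g' t| ≤ C :=
  abs_sub_le_iff.2 ⟨runMax_sub_le hg hg' ht h,
    runMax_sub_le hg' hg ht fun s hs hst => by rw [abs_sub_comm]; exact h s hs hst⟩

theorem runMax_mono {g : ℝ → ℝ} (hg : Continuous g) {s t : ℝ} (hs : 0 ≤ s) (hst : s ≤ t) :
    runMax g s ≤ runMax g t := by
  obtain ⟨r, hr, hrs, e⟩ := exists_runMax_eq hg hs
  rw [e]
  exact le_runMax hg hr (hrs.trans hst)

theorem runMax_nonneg {g : ℝ → ℝ} (hg : Continuous g) {t : ℝ} (ht : 0 ≤ t) : 0 ≤ runMax g t :=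
  (le_max_left _ _).trans (le_runMax hg le_rfl ht)

/-- The running maximum can grow between two times only if it is attained between them, where `g`
exceeds its earlier value by at most `K` times the elapsed time. -/
theorem lipschitzOnWith_runMax {g : ℝ → ℝ} (hg : Continuous g) {K : NNReal} {δ : ℝ}
    (hL : LipschitzOnWith K g (Icc 0 δ)) : LipschitzOnWith K (runMax g) (Icc 0 δ) := by
  refine LipschitzOnWith.of_le_add_mul _ fun x hx y hy => ?_
  rcases le_total x y with h | h
  · have := runMax_mono hg hx.1 h
    have : 0 ≤ K * dist x y := by positivity
    linarith
  · obtain ⟨r, hr, hrx, e⟩ := exists_runMax_eq hg hx.1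
    have h0 : 0 ≤ (K : ℝ) * dist x y := by positivity
    rcases le_total r y with h' | h'
    · have := le_runMax hg hr h'
      rw [e]; linarith
    · have h1 := le_runMax hg hy.1 le_rfl
      have h2 := hL.dist_le_mul r ⟨hr, hrx.trans hx.2⟩ y hy
      have h3 : (K : ℝ) * dist r y ≤ K * dist x y := by
        refine mul_le_mul_of_nonneg_left ?_ K.2
        rw [Real.dist_eq, Real.dist_eq, abs_of_nonneg (by linarith), abs_of_nonneg (by linarith)]
        linarith
      rw [Real.dist_eq] at h2
      have h4 := (abs_le.1 h2).2
      rw [e, max_le_iff]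
      have h5 := le_max_left 0 (g y)
      have h6 := le_max_right 0 (g y)
      constructor <;> linarith

/-- The reflection of the path `y` at the lower barrier `lo`. -/
def reflectAbove (lo : ℝ) (y : ℝ → ℝ) (t : ℝ) : ℝ := y t + runMax (fun s => lo - y s) t

theorem continuous_reflectAbove {lo : ℝ} {y : ℝ → ℝ} (hy : Continuous y) :
    Continuous (reflectAbove lo y) :=
  hy.add (continuous_runMax (by fun_prop))

theorem le_reflectAbove {lo : ℝ} {y : ℝ → ℝ} (hy : Continuous y) {t : ℝ} (ht : 0 ≤ t) :
    lo ≤ reflectAbove lo y t := by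
  have h1 := le_runMax (g := fun s => lo - y s) (by fun_prop) ht le_rfl
  have h2 := le_max_right 0 (lo - y t)
  unfold reflectAbove
  linarith

theorem reflectAbove_zero {lo : ℝ} {y : ℝ → ℝ} (hy : Continuous y) (h : lo ≤ y 0) :
    reflectAbove lo y 0 = y 0 := by
  obtain ⟨s, hs, hs', e⟩ := exists_runMax_eq (g := fun s => lo - y s) (by fun_prop) le_rfl
  obtain rfl : s = 0 := le_antisymm hs' hs
  unfold reflectAbove
  rw [e, max_eq_left (by linarith), add_zero]

theorem abs_reflectAbove_sub_le {lo : ℝ} {y y' : ℝ → ℝ} (hy : Continuous y) (hy' : Continuous y')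
    {t C : ℝ} (ht : 0 ≤ t) (h : ∀ s, 0 ≤ s → s ≤ t → |y s - y' s| ≤ C) :
    |reflectAbove lo y t - reflectAbove lo y' t| ≤ 2 * C := by
  have h1 := h t ht le_rfl
  have h2 := abs_runMax_sub_le (g := fun s => lo - y s) (g' := fun s => lo - y' s) (by fun_prop)
    (by fun_prop) ht (C := C) (fun s hs hst => by
      rw [sub_sub_sub_cancel_left, abs_sub_comm]; exact h s hs hst)
  unfold reflectAbove
  rw [add_sub_add_comm]
  exact (abs_add_le _ _).trans (by linarith)

theorem lipschitzOnWith_reflectAbove {lo : ℝ} {y : ℝ → ℝ} (hy : Continuous y) {K : NNReal} {δ : ℝ}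
    (hL : LipschitzOnWith K y (Icc 0 δ)) :
    LipschitzOnWith (K + K) (reflectAbove lo y) (Icc 0 δ) := by
  refine hL.add (lipschitzOnWith_runMax (by fun_prop) ?_)
  refine LipschitzOnWith.of_dist_le_mul fun a ha b hb => ?_
  rw [dist_sub_left]
  exact hL.dist_le_mul a ha b hb

/-- The reflected path solves the projected differential equation as long as it stays below the
upper barrier. -/
theorem hasDerivAt_reflectAbove {lo hi : ℝ} {y : ℝ → ℝ} (hy : Continuous y) {t u : ℝ} (ht : 0 < t)
    (hyd : HasDerivAt y u t) (hd : DifferentiableAt ℝ (reflectAbove lo y) t)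
    (hhi : reflectAbove lo y t < hi) :
    HasDerivAt (reflectAbove lo y) (projBox lo hi (reflectAbove lo y t) u) t := by
  have hg : Continuous fun s => lo - y s := by fun_prop
  set R := runMax fun s => lo - y s with hR
  rcases (le_reflectAbove (lo := lo) hy ht.le).eq_or_lt with h | h
  -- Contact with the barrier: the reflected path is minimal there, so its derivative is 0. The
  -- compensator `R` then has derivative `-u`, and its monotonicity forces `u ≤ 0`, exactly the case
  -- in which the projection vanishes.
  · have hmin : IsLocalMin (reflectAbove lo y) t := by
      filter_upwards [lt_mem_nhds ht] with s hs
      rw [← h]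
      exact le_reflectAbove hy hs.le
    have h0 : HasDerivAt (reflectAbove lo y) 0 t := by
      have := hd.hasDerivAt
      rwa [hmin.deriv_eq_zero] at this
    have hR' : HasDerivAt R (0 - u) t := by
      have := h0.sub hyd
      refine this.congr_of_eventuallyEq (Eventually.of_forall fun s => ?_)
      simp [reflectAbove, hR]
    have hu : 0 ≤ 0 - u := by
      have hm : MonotoneOn R (Ici t) := fun a ha b _ hab => runMax_mono hg (ht.le.trans ha) hab
      have := hm.derivWithin_nonneg (x := t)
      rwa [hR'.hasDerivWithinAt.derivWithin (uniqueDiffOn_Ici t t self_mem_Ici)] at this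
    have : projBox lo hi (reflectAbove lo y t) u = 0 := by
      unfold projBox
      rw [if_pos (Or.inl ⟨by linarith, by linarith⟩)]
    rw [this]
    exact h0
  · have hne : projBox lo hi (reflectAbove lo y t) u = u := projBox_of_mem_Ioo h hhi u
    rw [hne]
    have hlt : lo - y t < R t := by
      have : reflectAbove lo y t = y t + R t := rfl
      linarith
    -- Off the barrier `lo - y` stays strictly below `R t` near `t`, so no new maximum is reached
    -- and the compensator is locally constant.
    have hconst : ∀ᶠ s in 𝓝 t, R s = R t := by
      have hev : ∀ᶠ s in 𝓝 t, lo - y s < R t := hg.continuousAt.eventually_lt_const hlt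
      obtain ⟨ε, hε, hball⟩ := Metric.eventually_nhds_iff.1 hev
      filter_upwards [lt_mem_nhds ht, Metric.ball_mem_nhds t hε] with s hs hsε
      rw [Metric.mem_ball, Real.dist_eq, abs_lt] at hsε
      have hR0 : 0 ≤ R t := runMax_nonneg hg ht.le
      rcases le_total s t with hst | hst
      · refine le_antisymm (runMax_mono hg hs.le hst) ?_
        obtain ⟨r, hr, hrt, e⟩ := exists_runMax_eq hg ht.le
        change R t = _ at e
        rcases le_total r s with hrs | hrs
        · rw [e]; exact le_runMax hg hr hrs
        · have hlt' : lo - y r < R t := hball (by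
            rw [Real.dist_eq, abs_lt]; constructor <;> linarith)
          rcases max_choice 0 (lo - y r) with hm | hm
          · rw [e, hm]; exact runMax_nonneg hg hs.le
          · rw [hm] at e; linarith
      · refine le_antisymm ?_ (runMax_mono hg ht.le hst)
        obtain ⟨r, hr, hrs, e⟩ := exists_runMax_eq hg hs.le
        change R s = _ at e
        rw [e, max_le_iff]
        refine ⟨hR0, ?_⟩
        rcases le_total r t with hrt | hrt
        · exact (le_max_right _ _).trans (le_runMax hg hr hrt)
        · exact (hball (by rw [Real.dist_eq, abs_lt]; constructor <;> linarith)).le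
    have : HasDerivAt (fun s => y s + R t) u t := hyd.add_const _
    refine this.congr_of_eventuallyEq ?_
    filter_upwards [hconst] with s hs
    simp only [reflectAbove]
    rw [← hR, hs]

/-- Local solutions of a functional integral equation with a causal Lipschitz path
transformation. -/
theorem exists_local_functional_integral_eq {E : Type*} [NormedAddCommGroup E] [NormedSpace ℝ E]
    [CompleteSpace E] {f : E → E} {K : NNReal} (hf : LipschitzWith K f) (Γ : (ℝ → E) → ℝ → E)
    (hΓc : ∀ Y, Continuous Y → Continuous (Γ Y))
    (hΓ : ∀ Y Y', Continuous Y → Continuous Y' → ∀ t C, 0 ≤ t →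
      (∀ s, 0 ≤ s → s ≤ t → ‖Y s - Y' s‖ ≤ C) → ‖Γ Y t - Γ Y' t‖ ≤ 2 * C) (z₀ : E) :
    ∃ δ > 0, ∃ Y : ℝ → E, Continuous Y ∧
      ∀ t ∈ Icc 0 δ, Y t = z₀ + ∫ s in (0 : ℝ)..t, f (Γ Y s) := by
  -- This gives `K * δ ≤ 1 / 4`, which with the factor 2 from `Γ` makes the integral operator a
  -- contraction of ratio 1/2.
  set δ : ℝ := 1 / (4 * (K + 1)) with hδ
  have hK : (0 : ℝ) ≤ K := K.2
  have hδ0 : 0 < δ := by positivity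
  set ext : C(Icc (0 : ℝ) δ, E) → ℝ → E := fun Y => IccExtend hδ0.le Y with hext
  have hextc : ∀ Y, Continuous (ext Y) := fun Y => Y.continuous.Icc_extend'
  have hic : ∀ Y : ℝ → E, Continuous Y → Continuous fun s => f (Γ Y s) := fun Y hY =>
    hf.continuous.comp (hΓc Y hY)
  have hprim : ∀ Y : ℝ → E, Continuous Y →
      Continuous fun t => z₀ + ∫ s in (0 : ℝ)..t, f (Γ Y s) := fun Y hY =>
    continuous_const.add
      (intervalIntegral.continuous_primitive (fun a b => (hic Y hY).intervalIntegrable a b) 0)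
  set Φ : C(Icc (0 : ℝ) δ, E) → C(Icc (0 : ℝ) δ, E) := fun Y =>
    ⟨fun t => z₀ + ∫ s in (0 : ℝ)..t, f (Γ (ext Y) s),
      (hprim (ext Y) (hextc Y)).comp continuous_subtype_val⟩ with hΦ
  have hcontr : ContractingWith (1 / 2) Φ := by
    refine ⟨by norm_num, LipschitzWith.of_dist_le_mul fun Y Y' => ?_⟩
    rw [ContinuousMap.dist_le (by positivity)]
    rintro ⟨t, ht⟩
    simp only [hΦ, ContinuousMap.coe_mk, dist_add_left]
    rw [dist_eq_norm, ← intervalIntegral.integral_sub ((hic _ (hextc Y)).intervalIntegrable _ _)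
      ((hic _ (hextc Y')).intervalIntegrable _ _)]
    have hb : ∀ s ∈ uIoc (0 : ℝ) t, ‖f (Γ (ext Y) s) - f (Γ (ext Y') s)‖ ≤ K * (2 * dist Y Y') := by
      intro s hs
      rw [uIoc_of_le ht.1] at hs
      refine (hf.norm_sub_le _ _).trans (mul_le_mul_of_nonneg_left ?_ hK)
      refine hΓ _ _ (hextc Y) (hextc Y') s _ hs.1.le fun r _ _ => ?_
      rw [← dist_eq_norm]
      exact ContinuousMap.dist_apply_le_dist _
    refine (intervalIntegral.norm_integral_le_of_norm_le_const hb).trans ?_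
    rw [sub_zero, abs_of_nonneg ht.1]
    have h1 : K * (2 * dist Y Y') * t ≤ K * (2 * dist Y Y') * δ :=
      mul_le_mul_of_nonneg_left ht.2 (by positivity)
    have h2 : K * δ ≤ 1 / 4 := by
      rw [hδ, mul_one_div, div_le_div_iff₀ (by positivity) (by norm_num)]
      linarith
    have h3 : 0 ≤ dist Y Y' := dist_nonneg
    push_cast
    nlinarith
  set Y := hcontr.fixedPoint Φ with hY
  have hfix : Φ Y = Y := hcontr.fixedPoint_isFixedPt
  refine ⟨δ, hδ0, ext Y, hextc Y, fun t ht => ?_⟩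
  have h1 : ext Y t = Y ⟨t, ht⟩ := IccExtend_of_mem hδ0.le Y ht
  rw [h1]
  conv_lhs => rw [← hfix]
  rfl

end

noncomputable section

/-! ### Lipschitz functions -/

/-- `f` is Lipschitz with some constant. -/
def IsLipschitz {X Y : Type*} [PseudoMetricSpace X] [PseudoMetricSpace Y] (f : X → Y) : Prop :=
  ∃ K : NNReal, LipschitzWith K f

namespace IsLipschitz

variable {X Y Z : Type*} [PseudoMetricSpace X] [PseudoMetricSpace Y] [PseudoMetricSpace Z]

theorem of_const (y : Y) : IsLipschitz fun _ : X => y := ⟨0, LipschitzWith.const y⟩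

theorem continuous {f : X → Y} (hf : IsLipschitz f) : Continuous f := hf.choose_spec.continuous

theorem add {f g : X → ℝ} (hf : IsLipschitz f) (hg : IsLipschitz g) :
    IsLipschitz fun x => f x + g x := by
  obtain ⟨K, hK⟩ := hf
  obtain ⟨L, hL⟩ := hg
  exact ⟨K + L, hK.add hL⟩

theorem neg {f : X → ℝ} (hf : IsLipschitz f) : IsLipschitz fun x => -f x := by
  obtain ⟨K, hK⟩ := hf
  exact ⟨K, hK.neg⟩

theorem sub {f g : X → ℝ} (hf : IsLipschitz f) (hg : IsLipschitz g) :
    IsLipschitz fun x => f x - g x := by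
  obtain ⟨K, hK⟩ := hf
  obtain ⟨L, hL⟩ := hg
  exact ⟨K + L, hK.sub hL⟩

theorem const_mul {f : X → ℝ} (c : ℝ) (hf : IsLipschitz f) : IsLipschitz fun x => c * f x := by
  obtain ⟨K, hK⟩ := hf
  exact ⟨‖c‖₊ * K, (lipschitzWith_smul (β := ℝ) c).comp hK⟩

theorem min {f g : X → ℝ} (hf : IsLipschitz f) (hg : IsLipschitz g) :
    IsLipschitz fun x => Min.min (f x) (g x) := by
  obtain ⟨K, hK⟩ := hf
  obtain ⟨L, hL⟩ := hg
  exact ⟨_, hK.min hL⟩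

theorem max {f g : X → ℝ} (hf : IsLipschitz f) (hg : IsLipschitz g) :
    IsLipschitz fun x => Max.max (f x) (g x) := by
  obtain ⟨K, hK⟩ := hf
  obtain ⟨L, hL⟩ := hg
  exact ⟨_, hK.max hL⟩

theorem prodMk {f : X → Y} {g : X → Z} (hf : IsLipschitz f) (hg : IsLipschitz g) :
    IsLipschitz fun x => (f x, g x) := by
  obtain ⟨K, hK⟩ := hf
  obtain ⟨L, hL⟩ := hg
  exact ⟨_, hK.prodMk hL⟩

theorem pi {ι : Type*} [Fintype ι] {f : X → ι → ℝ} (hf : ∀ i, IsLipschitz fun x => f x i) :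
    IsLipschitz f := by
  choose K hK using hf
  refine ⟨Finset.univ.sup K, LipschitzWith.of_dist_le_mul fun x y => ?_⟩
  rw [dist_pi_le_iff (by positivity)]
  intro i
  refine ((hK i).dist_le_mul x y).trans (mul_le_mul_of_nonneg_right ?_ dist_nonneg)
  exact_mod_cast Finset.le_sup (Finset.mem_univ i)

theorem eval {ι : Type*} [Fintype ι] (i : ι) : IsLipschitz fun x : ι → ℝ => x i :=
  ⟨1, LipschitzWith.eval i⟩

theorem comp {f : Y → Z} {g : X → Y} (hf : IsLipschitz f) (hg : IsLipschitz g) :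
    IsLipschitz fun x => f (g x) := by
  obtain ⟨K, hK⟩ := hf
  obtain ⟨L, hL⟩ := hg
  exact ⟨_, hK.comp hL⟩

theorem fst : IsLipschitz (Prod.fst : X × Y → X) := ⟨1, LipschitzWith.prod_fst⟩

theorem snd : IsLipschitz (Prod.snd : X × Y → Y) := ⟨1, LipschitzWith.prod_snd⟩

end IsLipschitz

/-! ### Lipschitz dependence of the closed loop on the state -/

namespace PowerState

variable {n : ℕ}

theorem isLipschitz_angle : IsLipschitz (angle : PowerState n → _) := IsLipschitz.fst

theorem isLipschitz_freq (i : Fin (n + 1)) : IsLipschitz fun z : PowerState n => z.freq i :=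
  (IsLipschitz.eval i).comp (IsLipschitz.fst.comp IsLipschitz.snd)

theorem isLipschitz_genRef (i : Fin (n + 1)) : IsLipschitz fun z : PowerState n => z.genRef i :=
  (IsLipschitz.eval i).comp (IsLipschitz.fst.comp (IsLipschitz.snd.comp IsLipschitz.snd))

theorem isLipschitz_mult (i : Fin (n + 1)) : IsLipschitz fun z : PowerState n => z.mult i :=
  (IsLipschitz.eval i).comp (IsLipschitz.snd.comp (IsLipschitz.snd.comp IsLipschitz.snd))

end PowerState

namespace PowerSystem

open PowerState

variable {n m : ℕ} (S : PowerSystem n m)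

theorem isLipschitz_tiePower (i : Fin (n + 1)) :
    IsLipschitz fun z : PowerState n => S.tiePower z.angle i := by
  have h : IsLipschitz (S.tiePower) :=
    ⟨_, (LinearMap.toContinuousLinearMap (Matrix.mulVecLin
      (S.incidence * Matrix.diagonal S.B * S.reducedIncidence.transpose))).lipschitz⟩
  exact (IsLipschitz.eval i).comp (h.comp isLipschitz_angle)

theorem isLipschitz_barrierLower (i : Fin (n + 1)) : IsLipschitz fun z => S.barrierLower z i :=
  ((((isLipschitz_freq i).const_mul _).add (.of_const _)).add (S.isLipschitz_tiePower i)).add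
    (((IsLipschitz.of_const _).sub (isLipschitz_freq i)).const_mul _)

theorem isLipschitz_barrierUpper (i : Fin (n + 1)) : IsLipschitz fun z => S.barrierUpper z i :=
  ((((isLipschitz_freq i).const_mul _).add (.of_const _)).add (S.isLipschitz_tiePower i)).sub
    (((isLipschitz_freq i).sub (.of_const _)).const_mul _)

theorem isLipschitz_generation (i : Fin (n + 1)) : IsLipschitz fun z => S.generation z i :=
  ((isLipschitz_genRef i).max ((IsLipschitz.of_const _).max (S.isLipschitz_barrierLower i))).min
    ((IsLipschitz.of_const _).min (S.isLipschitz_barrierUpper i))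

/-- The rate of change of the frequency of area `i`. -/
def freqRate (z : PowerState n) (i : Fin (n + 1)) : ℝ :=
  (S.M i)⁻¹ * (-(S.D i * z.freq i) + S.generation z i - S.d i - S.tiePower z.angle i)

/-- The unprojected rate of change of the generation reference of area `i`. -/
def refDrive (z : PowerState n) (i : Fin (n + 1)) : ℝ :=
  -(S.a i * z.genRef i) - S.b i - z.mult i - z.freq i

/-- The rate of change of the generation reference of area `i`. -/
def refRate (z : PowerState n) (i : Fin (n + 1)) : ℝ :=
  projBox (S.Pmin i) (S.Pmax i) (z.genRef i) (S.refDrive z i)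

theorem isLipschitz_freqRate (i : Fin (n + 1)) : IsLipschitz fun z => S.freqRate z i :=
  (((((isLipschitz_freq i).const_mul _).neg.add (S.isLipschitz_generation i)).sub
    (.of_const _)).sub (S.isLipschitz_tiePower i)).const_mul _

theorem isLipschitz_refDrive (i : Fin (n + 1)) : IsLipschitz fun z => S.refDrive z i :=
  ((((isLipschitz_genRef i).const_mul _).neg.sub (.of_const _)).sub
    (isLipschitz_mult i)).sub (isLipschitz_freq i)

/-- The right-hand side of the closed-loop system without the projection. -/
def freeField (z : PowerState n) : PowerState n :=
  (fun k => z.freq k.castSucc - z.freq (Fin.last n), S.freqRate z, S.refDrive z,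
    fun i => z.genRef i - S.d i)

theorem isLipschitz_freeField : IsLipschitz S.freeField := by
  refine .prodMk (.pi fun k => ?_) (.prodMk (.pi S.isLipschitz_freqRate)
    (.prodMk (.pi S.isLipschitz_refDrive) (.pi fun i => ?_)))
  · exact (isLipschitz_freq _).sub (isLipschitz_freq _)
  · exact (isLipschitz_genRef _).sub (.of_const _)

/-- The projected field is discontinuous; its continuous majorant supplies the velocity bounds on
bounded sets. -/
theorem norm_closedLoop_le (z : PowerState n) : ‖S.closedLoop z‖ ≤ ‖S.freeField z‖ := by
  have h : ‖(S.closedLoop z).2.2.1‖ ≤ ‖(S.freeField z).2.2.1‖ := by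
    rw [pi_norm_le_iff_of_nonneg (norm_nonneg _)]
    exact fun i => (abs_projBox_le _ _ _ _).trans (norm_le_pi_norm (S.freeField z).2.2.1 i)
  simp only [Prod.norm_def]
  exact max_le_max le_rfl (max_le_max le_rfl (max_le_max h le_rfl))

end PowerSystem

/-! ### Reflection at one of two barriers -/

/-- The reflection of a path that starts at `x₀ ∈ [lo, hi]`, at the lower barrier if `x₀ < hi` and
at the upper barrier otherwise. -/
def reflectNear (lo hi x₀ : ℝ) (y : ℝ → ℝ) (t : ℝ) : ℝ :=
  if x₀ < hi then reflectAbove lo y t else -reflectAbove (-hi) (fun s => -y s) t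

theorem continuous_reflectNear {lo hi x₀ : ℝ} {y : ℝ → ℝ} (hy : Continuous y) :
    Continuous (reflectNear lo hi x₀ y) := by
  unfold reflectNear
  split_ifs
  · exact continuous_reflectAbove hy
  · exact (continuous_reflectAbove hy.neg).neg

theorem abs_reflectNear_sub_le {lo hi x₀ : ℝ} {y y' : ℝ → ℝ} (hy : Continuous y)
    (hy' : Continuous y') {t C : ℝ} (ht : 0 ≤ t) (h : ∀ s, 0 ≤ s → s ≤ t → |y s - y' s| ≤ C) :
    |reflectNear lo hi x₀ y t - reflectNear lo hi x₀ y' t| ≤ 2 * C := by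
  unfold reflectNear
  split_ifs
  · exact abs_reflectAbove_sub_le hy hy' ht h
  · rw [neg_sub_neg, abs_sub_comm]
    refine abs_reflectAbove_sub_le hy.fun_neg hy'.fun_neg ht fun s hs hst => ?_
    rw [neg_sub_neg, abs_sub_comm]
    exact h s hs hst

theorem lipschitzOnWith_reflectNear {lo hi x₀ : ℝ} {y : ℝ → ℝ} (hy : Continuous y) {K : NNReal}
    {δ : ℝ} (hL : LipschitzOnWith K y (Icc 0 δ)) :
    LipschitzOnWith (K + K) (reflectNear lo hi x₀ y) (Icc 0 δ) := by
  unfold reflectNear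
  split_ifs
  · exact lipschitzOnWith_reflectAbove hy hL
  · exact (lipschitzOnWith_reflectAbove hy.neg hL.neg).neg

theorem reflectNear_zero {lo hi : ℝ} {y : ℝ → ℝ} (hy : Continuous y) (h : lo ≤ y 0 ∧ y 0 ≤ hi) :
    reflectNear lo hi (y 0) y 0 = y 0 := by
  unfold reflectNear
  split_ifs
  · exact reflectAbove_zero hy h.1
  · rw [reflectAbove_zero hy.fun_neg (neg_le_neg h.2), neg_neg]

theorem projBox_neg (lo hi x u : ℝ) : projBox (-hi) (-lo) (-x) (-u) = -projBox lo hi x u := by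
  unfold projBox
  have : ((-x - -hi = 0 ∧ -u ≤ 0) ∨ (-lo - -x = 0 ∧ 0 ≤ -u)) ↔
      ((x - lo = 0 ∧ u ≤ 0) ∨ (hi - x = 0 ∧ 0 ≤ u)) := by
    rw [or_comm, neg_sub_neg, neg_sub_neg, neg_nonneg, neg_nonpos]
  rw [if_congr this rfl rfl]
  split_ifs <;> simp

/-- For a short time the reflected path stays between the barriers and solves the projected
differential equation. -/
theorem reflectNear_spec {lo hi : ℝ} (hlt : lo < hi) {y : ℝ → ℝ} (hy : Continuous y)
    (h : lo ≤ y 0 ∧ y 0 ≤ hi) :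
    ∀ᶠ t in 𝓝 (0 : ℝ), 0 ≤ t →
      (lo ≤ reflectNear lo hi (y 0) y t ∧ reflectNear lo hi (y 0) y t ≤ hi) ∧
      ∀ u, 0 < t → HasDerivAt y u t → DifferentiableAt ℝ (reflectNear lo hi (y 0) y) t →
        HasDerivAt (reflectNear lo hi (y 0) y)
          (projBox lo hi (reflectNear lo hi (y 0) y t) u) t := by
  have h0 := reflectNear_zero hy h
  have hc := (continuous_reflectNear (lo := lo) (hi := hi) (x₀ := y 0) hy).continuousAt (x := 0)
  unfold reflectNear at hc h0 ⊢
  split_ifs at hc h0 ⊢ with hx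
  -- The start is away from the barrier that is not reflected at, and continuity keeps the path away
  -- from it for a short time.
  · have : ∀ᶠ t in 𝓝 (0 : ℝ), reflectAbove lo y t < hi := hc.eventually_lt_const (by
      simp only; rwa [h0])
    filter_upwards [this] with t ht ht0
    exact ⟨⟨le_reflectAbove hy ht0, ht.le⟩, fun u htp hu hd =>
      hasDerivAt_reflectAbove hy htp hu hd ht⟩
  · have : ∀ᶠ t in 𝓝 (0 : ℝ), lo < -reflectAbove (-hi) (fun s => -y s) t :=
      hc.eventually_const_lt (by simp only; rw [h0]; linarith)
    filter_upwards [this] with t ht ht0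
    have hle := le_reflectAbove (lo := -hi) hy.fun_neg ht0
    refine ⟨⟨ht.le, by linarith⟩, fun u htp hu hd => ?_⟩
    have hd' : DifferentiableAt ℝ (reflectAbove (-hi) fun s => -y s) t := by
      simpa using hd.fun_neg
    have := (hasDerivAt_reflectAbove (hi := -lo) hy.fun_neg htp hu.fun_neg hd' (by linarith)).neg
    rw [← projBox_neg, neg_neg, neg_neg, neg_neg] at this
    exact this

/-! ### Local existence for the projected system -/

namespace PowerSystem

open PowerState

variable {n m : ℕ} (S : PowerSystem n m)

/-- The reflection of the generation references of a path in the state space. -/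
def reflectPath (z₀ : PowerState n) (Y : ℝ → PowerState n) (t : ℝ) : PowerState n :=
  ((Y t).angle, (Y t).freq,
    fun i => reflectNear (S.Pmin i) (S.Pmax i) (z₀.genRef i) (fun s => (Y s).genRef i) t,
    (Y t).mult)

theorem continuous_reflectPath (z₀ : PowerState n) {Y : ℝ → PowerState n} (hY : Continuous Y) :
    Continuous (S.reflectPath z₀ Y) := by
  refine .prodMk hY.fst (.prodMk hY.snd.fst (.prodMk (continuous_pi fun i => ?_) hY.snd.snd.snd))
  exact continuous_reflectNear ((isLipschitz_genRef i).continuous.comp hY)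

theorem norm_reflectPath_sub_le (z₀ : PowerState n) {Y Y' : ℝ → PowerState n} (hY : Continuous Y)
    (hY' : Continuous Y') {t C : ℝ} (ht : 0 ≤ t) (h : ∀ s, 0 ≤ s → s ≤ t → ‖Y s - Y' s‖ ≤ C) :
    ‖S.reflectPath z₀ Y t - S.reflectPath z₀ Y' t‖ ≤ 2 * C := by
  have hC : 0 ≤ C := (norm_nonneg _).trans (h t ht le_rfl)
  have h1 := h t ht le_rfl
  simp only [Prod.norm_def, max_le_iff] at h1 ⊢
  refine ⟨h1.1.trans (by linarith), h1.2.1.trans (by linarith), ?_, h1.2.2.2.trans (by linarith)⟩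
  rw [pi_norm_le_iff_of_nonneg (by linarith)]
  intro i
  refine abs_reflectNear_sub_le ((isLipschitz_genRef i).continuous.comp hY)
    ((isLipschitz_genRef i).continuous.comp hY') ht fun s hs hst => ?_
  have h2 := h s hs hst
  simp only [Prod.norm_def, max_le_iff] at h2
  exact (norm_le_pi_norm (Y s - Y' s).2.2.1 i).trans h2.2.2.1

theorem lipschitzOnWith_reflectPath (z₀ : PowerState n) {Y : ℝ → PowerState n} (hY : Continuous Y)
    {K : NNReal} {δ : ℝ} (hL : LipschitzOnWith K Y (Icc 0 δ)) :
    LipschitzOnWith (K + K) (S.reflectPath z₀ Y) (Icc 0 δ) := by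
  refine LipschitzOnWith.of_dist_le_mul fun s hs t ht => ?_
  have h1 := hL.dist_le_mul s hs t ht
  have h0 : 0 ≤ (K : ℝ) * dist s t := by positivity
  rw [NNReal.coe_add, add_mul]
  simp only [Prod.dist_eq, max_le_iff] at h1 ⊢
  refine ⟨h1.1.trans (by linarith), h1.2.1.trans (by linarith), ?_, h1.2.2.2.trans (by linarith)⟩
  rw [dist_pi_le_iff (by linarith), ← add_mul, ← NNReal.coe_add]
  intro i
  refine (lipschitzOnWith_reflectNear ((isLipschitz_genRef i).continuous.comp hY)
    (LipschitzOnWith.of_dist_le_mul fun a ha b hb => ?_)).dist_le_mul s hs t ht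
  have h2 := hL.dist_le_mul a ha b hb
  simp only [Prod.dist_eq, max_le_iff] at h2
  exact (dist_le_pi_dist (Y a).2.2.1 (Y b).2.2.1 i).trans h2.2.2.1

/-- Local existence of solutions of the closed-loop projected system. -/
theorem exists_local_solution (hP : ∀ i, S.Pmin i < S.Pmax i) {z₀ : PowerState n}
    (hz₀ : z₀ ∈ S.stateSet) :
    ∃ δ > 0, ∃ (K : NNReal) (z : ℝ → PowerState n), z 0 = z₀ ∧ LipschitzOnWith K z (Icc 0 δ) ∧
      (∀ t ∈ Icc 0 δ, z t ∈ S.stateSet) ∧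
      ∀ᵐ t : ℝ, t ∈ Ioo 0 δ → HasDerivAt z (S.closedLoop (z t)) t := by
  obtain ⟨K, hK⟩ := S.isLipschitz_freeField
  -- `Y` is the unconstrained path, driven by the free field evaluated at its own reflection `z`.
  -- Hence the reference components of `Y` have derivative `refDrive (z t)`, and reflecting them
  -- inserts the projection.
  obtain ⟨δ₁, hδ₁, Y, hYc, hY⟩ := exists_local_functional_integral_eq hK (S.reflectPath z₀)
    (fun Y hY => S.continuous_reflectPath z₀ hY)
    (fun Y Y' hY hY' t C ht h => S.norm_reflectPath_sub_le z₀ hY hY' ht h) z₀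
  set z := S.reflectPath z₀ Y with hz
  have hY0 : Y 0 = z₀ := by simpa using hY 0 ⟨le_rfl, hδ₁.le⟩
  have hzc : Continuous z := S.continuous_reflectPath z₀ hYc
  have hfc : Continuous fun s => S.freeField (z s) := hK.continuous.comp hzc
  have hyc : ∀ i, Continuous fun s => (Y s).genRef i := fun i =>
    (isLipschitz_genRef i).continuous.comp hYc
  have hprim : ∀ t, HasDerivAt (fun t => z₀ + ∫ s in (0 : ℝ)..t, S.freeField (z s))
      (S.freeField (z t)) t := fun t =>
    (intervalIntegral.integral_hasDerivAt_right (hfc.intervalIntegrable _ _)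
      (hfc.stronglyMeasurableAtFilter _ _) hfc.continuousAt).const_add z₀
  have hYd : ∀ t ∈ Ioo 0 δ₁, HasDerivAt Y (S.freeField (z t)) t := by
    intro t ht
    refine (hprim t).congr_of_eventuallyEq ?_
    filter_upwards [Icc_mem_nhds ht.1 ht.2] with s hs
    exact hY s hs
  obtain ⟨L, hL⟩ : ∃ L : NNReal, LipschitzOnWith L Y (Icc 0 δ₁) := by
    obtain ⟨C, hC⟩ := isCompact_Icc.exists_bound_of_continuousOn (s := Icc 0 δ₁) hfc.continuousOn
    refine ⟨C.toNNReal, ?_⟩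
    have := (convex_Icc 0 δ₁).lipschitzOnWith_of_nnnorm_hasDerivWithin_le (C := C.toNNReal)
      (fun t _ => (hprim t).hasDerivWithinAt) (fun t ht => by
        rw [← NNReal.coe_le_coe, coe_nnnorm]
        exact (hC t ht).trans (Real.le_coe_toNNReal C))
    refine LipschitzOnWith.of_dist_le_mul fun a ha b hb => ?_
    rw [hY a ha, hY b hb]
    exact this.dist_le_mul a ha b hb
  have hev := eventually_all.2 fun i => reflectNear_spec (hP i) (hyc i) (by
    simp only [hY0]; exact hz₀ i)
  simp only [hY0] at hev
  obtain ⟨ε, hε, hball⟩ := Metric.eventually_nhds_iff.1 hev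
  have hspec : ∀ t, 0 ≤ t → t < ε → _ := fun t h0 ht =>
    hball (show dist t 0 < ε by rwa [Real.dist_eq, sub_zero, abs_of_nonneg h0])
  set δ := min δ₁ (ε / 2) with hδ
  have hδ0 : 0 < δ := by positivity
  have hzL : LipschitzOnWith (L + L) z (Icc 0 δ) :=
    (S.lipschitzOnWith_reflectPath z₀ hYc hL).mono (Icc_subset_Icc le_rfl (min_le_left _ _))
  have hzi : ∀ i, LipschitzOnWith (L + L) (fun t => (z t).genRef i) (Icc 0 δ) := by
    intro i
    refine LipschitzOnWith.of_dist_le_mul fun a ha b hb => ?_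
    have h2 := hzL.dist_le_mul a ha b hb
    simp only [Prod.dist_eq, max_le_iff] at h2
    exact (dist_le_pi_dist (z a).2.2.1 (z b).2.2.1 i).trans h2.2.2.1
  refine ⟨δ, hδ0, L + L, z, ?_, hzL, ?_, ?_⟩
  · have h0 : ∀ i, reflectNear (S.Pmin i) (S.Pmax i) (z₀.genRef i) (fun s => (Y s).genRef i) 0 =
        z₀.genRef i := by
      intro i
      have := reflectNear_zero (hyc i) (lo := S.Pmin i) (hi := S.Pmax i) (by
        simp only [hY0]; exact hz₀ i)
      simpa only [hY0] using this
    simp only [hz, reflectPath, hY0, h0]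
    rfl
  · intro t ht i
    have hle : δ ≤ ε / 2 := min_le_right _ _
    exact (hspec t ht.1 (by linarith [ht.2]) i ht.1).1
  -- The reflected components need not be differentiable everywhere; being Lipschitz, they are so
  -- almost everywhere.
  · have hae : ∀ᵐ t : ℝ, ∀ i, t ∈ uIcc 0 δ → DifferentiableAt ℝ (fun t => (z t).genRef i) t := by
      rw [ae_all_iff]
      intro i
      refine AbsolutelyContinuousOnInterval.ae_differentiableAt ?_
      refine LipschitzOnWith.absolutelyContinuousOnInterval (K := L + L) ?_
      rw [uIcc_of_le hδ0.le]
      exact hzi i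
    filter_upwards [hae] with t ht htm
    have hle : δ ≤ ε / 2 := min_le_right _ _
    have hYt := hYd t ⟨htm.1, htm.2.trans_le (min_le_left _ _)⟩
    have hpi : ∀ i, HasDerivAt (fun s => (Y s).genRef i) (S.refDrive (z t) i) t := fun i =>
      hasDerivAt_pi.1 hYt.snd.snd.fst i
    refine HasDerivAt.prodMk hYt.fst (HasDerivAt.prodMk hYt.snd.fst
      (HasDerivAt.prodMk (hasDerivAt_pi.2 fun i => ?_) hYt.snd.snd.snd))
    refine (hspec t htm.1.le (by linarith [htm.2]) i htm.1.le).2 _ htm.1 (hpi i) ?_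
    exact ht i (by rw [uIcc_of_le hδ0.le]; exact ⟨htm.1.le, htm.2.le⟩)

end PowerSystem

end

/-! ### A priori bounds and continuation of solutions -/

noncomputable section

/-- A norming functional of the increment reduces this to the scalar case. -/
theorem AbsolutelyContinuousOnInterval.norm_sub_le_mul {E : Type*} [NormedAddCommGroup E]
    [NormedSpace ℝ E] {f : ℝ → E} {a b C : ℝ} (hab : a ≤ b)
    (hf : AbsolutelyContinuousOnInterval f a b)
    (h : ∀ᵐ t : ℝ, t ∈ Ioo a b → ∃ f', HasDerivAt f f' t ∧ ‖f'‖ ≤ C) :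
    ‖f b - f a‖ ≤ C * (b - a) := by
  obtain ⟨g, hg, hgx⟩ := exists_dual_vector'' ℝ (f b - f a)
  have h1 := (g.lipschitz.comp_absolutelyContinuousOnInterval hf).abs_sub_le_mul hab (C := C) ?_
  · rw [← map_sub, hgx] at h1
    exact (le_abs_self _).trans h1
  filter_upwards [h] with t ht hm
  obtain ⟨f', h2, h3⟩ := ht hm
  refine ⟨g f', g.hasFDerivAt.comp_hasDerivAt t h2, ?_⟩
  rw [← Real.norm_eq_abs]
  refine (g.le_opNorm f').trans ?_
  nlinarith [norm_nonneg f', norm_nonneg g]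

theorem LipschitzOnWith.glue_Icc {X : Type*} [PseudoMetricSpace X] {f : ℝ → X} {K L : NNReal}
    {a b c : ℝ} (h1 : LipschitzOnWith K f (Icc a b)) (h2 : LipschitzOnWith L f (Icc b c))
    (hab : a ≤ b) (hbc : b ≤ c) : LipschitzOnWith (max K L) f (Icc a c) := by
  have hK : (K : ℝ) ≤ (max K L : NNReal) := by exact_mod_cast le_max_left K L
  have hL : (L : ℝ) ≤ (max K L : NNReal) := by exact_mod_cast le_max_right K L
  have key : ∀ x ∈ Icc a c, ∀ y ∈ Icc a c, x ≤ y →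
      dist (f x) (f y) ≤ (max K L : NNReal) * dist x y := by
    intro x hx y hy hxy
    rcases le_total y b with hyb | hyb
    · exact (h1.dist_le_mul x ⟨hx.1, hxy.trans hyb⟩ y ⟨hy.1, hyb⟩).trans
        (mul_le_mul_of_nonneg_right hK dist_nonneg)
    rcases le_total b x with hbx | hbx
    · exact (h2.dist_le_mul x ⟨hbx, hx.2⟩ y ⟨hyb, hy.2⟩).trans
        (mul_le_mul_of_nonneg_right hL dist_nonneg)
    have e1 := (h1.dist_le_mul x ⟨hx.1, hbx⟩ b ⟨hab, le_rfl⟩).trans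
        (mul_le_mul_of_nonneg_right hK dist_nonneg)
    have e2 := (h2.dist_le_mul b ⟨le_rfl, hbc⟩ y ⟨hyb, hy.2⟩).trans
        (mul_le_mul_of_nonneg_right hL dist_nonneg)
    have e3 : dist x y = dist x b + dist b y := by
      rw [Real.dist_eq, Real.dist_eq, Real.dist_eq, abs_of_nonpos (by linarith),
        abs_of_nonpos (by linarith), abs_of_nonpos (by linarith)]
      ring
    rw [e3, mul_add]
    exact (dist_triangle _ (f b) _).trans (add_le_add e1 e2)
  refine LipschitzOnWith.of_dist_le_mul fun x hx y hy => ?_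
  rcases le_total x y with h | h
  · exact key x hx y hy h
  · rw [dist_comm, dist_comm x]
    exact key y hy x hx h

theorem PowerState.norm_le_iff {n : ℕ} {z : PowerState n} {R : ℝ} (hR : 0 ≤ R) :
    ‖z‖ ≤ R ↔ (∀ k, |z.angle k| ≤ R) ∧ (∀ i, |z.freq i| ≤ R) ∧ (∀ i, |z.genRef i| ≤ R) ∧
      ∀ i, |z.mult i| ≤ R := by
  simp only [Prod.norm_def, max_le_iff, pi_norm_le_iff_of_nonneg hR]
  rfl

namespace PowerSystem

open PowerState

variable {n m : ℕ} (S : PowerSystem n m)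

theorem M_mul_freqRate (z : PowerState n) (i : Fin (n + 1)) :
    S.M i * S.freqRate z i =
      -(S.D i * z.freq i) + S.generation z i - S.d i - S.tiePower z.angle i := by
  unfold freqRate
  rw [mul_inv_cancel_left₀ (S.M_pos i).ne']

variable {S}

theorem barrierLower_le_barrierUpper (z : PowerState n) (i : Fin (n + 1)) :
    S.barrierLower z i ≤ S.barrierUpper z i := by
  have h := mul_pos (S.β_pos i) (S.M_pos i)
  have h1 := S.wmin_neg i
  have h2 := S.wmax_pos i
  unfold barrierLower barrierUpper
  nlinarith

/-- In a feasible state the corrected generation respects all constraints, and it is one of the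
barrier bounds unless it is the generation reference. -/
theorem generation_spec {z : PowerState n} (hz : z ∈ S.stateSet) (hF : S.SafetyFeasible z)
    (i : Fin (n + 1)) :
    (S.Pmin i ≤ S.generation z i ∧ S.generation z i ≤ S.Pmax i) ∧
    (S.barrierLower z i ≤ S.generation z i ∧ S.generation z i ≤ S.barrierUpper z i) ∧
    (z.genRef i < S.generation z i → S.generation z i = S.barrierLower z i) ∧
    (S.generation z i < z.genRef i → S.generation z i = S.barrierUpper z i) := by
  obtain ⟨P, ⟨h1, h2⟩, h3, h4⟩ := hF i
  obtain ⟨h5, h6⟩ := hz i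
  have h7 := barrierLower_le_barrierUpper (S := S) z i
  unfold generation
  grind

/-- The barrier bounds on the generation are the swing equation solved for these bounds on ω. A
nonzero correction makes one of them an equality. -/
theorem freqRate_spec {z : PowerState n} (hz : z ∈ S.stateSet) (hF : S.SafetyFeasible z)
    (i : Fin (n + 1)) :
    (S.β i * (S.wmin i - z.freq i) ≤ S.freqRate z i ∧
      S.freqRate z i ≤ S.β i * (S.wmax i - z.freq i)) ∧
    (z.genRef i < S.generation z i → S.freqRate z i = S.β i * (S.wmin i - z.freq i)) ∧
    (S.generation z i < z.genRef i → S.freqRate z i = S.β i * (S.wmax i - z.freq i)) := by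
  obtain ⟨-, ⟨h1, h2⟩, h3, h4⟩ := S.generation_spec hz hF i
  have hM := S.M_pos i
  have e := S.M_mul_freqRate z i
  simp only [barrierLower, barrierUpper] at h1 h2 h3 h4
  refine ⟨⟨?_, ?_⟩, fun h => ?_, fun h => ?_⟩
  · refine le_of_mul_le_mul_left ?_ hM
    linarith
  · refine le_of_mul_le_mul_left ?_ hM
    linarith
  · refine mul_left_cancel₀ hM.ne' ?_
    linarith [h3 h]
  · refine mul_left_cancel₀ hM.ne' ?_
    linarith [h4 h]

section Solution

variable {T : EReal} {z : ℝ → PowerState n}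

theorem hasDerivAt_coord {t : ℝ} (h : HasDerivAt z (S.closedLoop (z t)) t) :
    (∀ k, HasDerivAt (fun s => (z s).angle k)
      ((z t).freq k.castSucc - (z t).freq (Fin.last n)) t) ∧
    (∀ i, HasDerivAt (fun s => (z s).freq i) (S.freqRate (z t) i) t) ∧
    (∀ i, HasDerivAt (fun s => (z s).genRef i) (S.refRate (z t) i) t) ∧
    (∀ i, HasDerivAt (fun s => (z s).mult i) ((z t).genRef i - S.d i) t) :=
  ⟨fun k => hasDerivAt_pi.1 h.fst k, fun i => hasDerivAt_pi.1 h.snd.fst i,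
    fun i => hasDerivAt_pi.1 h.snd.snd.fst i, fun i => hasDerivAt_pi.1 h.snd.snd.snd i⟩

theorem IsSolution.absCont_comp (hs : S.IsSolution T z) {f : PowerState n → ℝ}
    (hf : IsLipschitz f) {a b : ℝ} (ha : 0 ≤ a) (hab : a ≤ b) (hb : (b : EReal) < T) :
    AbsolutelyContinuousOnInterval (fun t => f (z t)) a b :=
  (hf.choose_spec.comp_absolutelyContinuousOnInterval
    (hs.absCont b (ha.trans hab) hb)).mono_Icc ha hab le_rfl

theorem IsSolution.ae_hasDerivAt (hs : S.IsSolution T z) {a b : ℝ} (ha : 0 ≤ a)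
    (hb : (b : EReal) < T) : ∀ᵐ t : ℝ, t ∈ Ioo a b → HasDerivAt z (S.closedLoop (z t)) t := by
  filter_upwards [hs.deriv] with t ht hm
  exact ht (ha.trans hm.1.le) ((EReal.coe_lt_coe_iff.2 hm.2).trans hb)

/-- Along feasible solutions the frequencies approach the safe interval exponentially. -/
theorem IsSolution.freq_bounds (hs : S.IsSolution T z)
    (hF : ∀ t : ℝ, 0 ≤ t → (t : EReal) < T → S.SafetyFeasible (z t)) (i : Fin (n + 1)) {t : ℝ}
    (ht : 0 ≤ t) (htT : (t : EReal) < T) :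
    S.wmin i - (z t).freq i ≤ |S.wmin i - (z 0).freq i| * Real.exp (-(S.β i * t)) ∧
    (z t).freq i - S.wmax i ≤ |(z 0).freq i - S.wmax i| * Real.exp (-(S.β i * t)) := by
  have hexp : AbsolutelyContinuousOnInterval (fun s => Real.exp (S.β i * s)) 0 t :=
    ContDiffOn.absolutelyContinuousOnInterval (by fun_prop)
  have hde : ∀ s, HasDerivAt (fun s => Real.exp (S.β i * s))
      (Real.exp (S.β i * s) * (S.β i * 1)) s := fun s =>
    ((hasDerivAt_id s).const_mul (S.β i)).exp
  have hw := hs.absCont_comp (isLipschitz_freq i) le_rfl ht htT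
  have hcancel : ∀ x y : ℝ, x * Real.exp (S.β i * t) ≤ y * Real.exp (S.β i * 0) →
      x ≤ |y| * Real.exp (-(S.β i * t)) := by
    intro x y h
    rw [mul_zero, Real.exp_zero, mul_one] at h
    rw [Real.exp_neg, ← div_eq_mul_inv, le_div_iff₀ (Real.exp_pos _)]
    exact h.trans (le_abs_self y)
  have hfeas : ∀ s ∈ Ioo 0 t, _ := fun s hm =>
    have hsT : (s : EReal) < T := (EReal.coe_lt_coe_iff.2 hm.2).trans htT
    S.freqRate_spec (hs.mem s hm.1.le hsT) (hF s hm.1.le hsT) i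
  constructor
  -- By the barrier condition the violation times exp(β t) is nonincreasing.
  · refine hcancel _ _ ((((AbsolutelyContinuousOnInterval.of_const (S.wmin i) 0 t).sub
      hw).mul hexp).le_of_deriv_nonpos ht ?_)
    filter_upwards [hs.ae_hasDerivAt le_rfl htT] with s hd hm
    have h1 := (hasDerivAt_coord (hd hm)).2.1 i
    refine ⟨_, ((hasDerivAt_const s (S.wmin i)).sub h1).mul (hde s), ?_⟩
    have h2 := (hfeas s hm).1.1
    have h3 := Real.exp_pos (S.β i * s)
    simp only [Pi.sub_apply]
    nlinarith
  · refine hcancel _ _ (((hw.sub (AbsolutelyContinuousOnInterval.of_const (S.wmax i) 0 t)).mul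
      hexp).le_of_deriv_nonpos ht ?_)
    filter_upwards [hs.ae_hasDerivAt le_rfl htT] with s hd hm
    have h1 := (hasDerivAt_coord (hd hm)).2.1 i
    refine ⟨_, (h1.sub (hasDerivAt_const s (S.wmax i))).mul (hde s), ?_⟩
    have h2 := (hfeas s hm).1.2
    have h3 := Real.exp_pos (S.β i * s)
    simp only [Pi.sub_apply]
    nlinarith

/-- A solution whose velocity is bounded by `C` moves at most with speed `C`. -/
theorem IsSolution.norm_sub_le (hs : S.IsSolution T z) {C a b : ℝ} (ha : 0 ≤ a) (hab : a ≤ b)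
    (hb : (b : EReal) < T) (hC : ∀ t ∈ Icc a b, ‖S.closedLoop (z t)‖ ≤ C) :
    ‖z b - z a‖ ≤ C * (b - a) := by
  refine ((hs.absCont b (ha.trans hab) hb).mono_Icc ha hab le_rfl).norm_sub_le_mul hab ?_
  filter_upwards [hs.ae_hasDerivAt ha hb] with t ht hm
  exact ⟨_, ht hm, hC t ⟨hm.1.le, hm.2.le⟩⟩

theorem IsSolution.lipschitzOnWith (hs : S.IsSolution T z) {C : NNReal} {s : Set ℝ}
    (hs0 : s ⊆ Ici 0) (hc : s.OrdConnected) (hsT : ∀ t ∈ s, (t : EReal) < T)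
    (hC : ∀ t ∈ s, ‖S.closedLoop (z t)‖ ≤ C) : LipschitzOnWith C z s := by
  have key : ∀ a ∈ s, ∀ b ∈ s, a ≤ b → dist (z a) (z b) ≤ C * dist a b := by
    intro a ha b hb hab
    rw [dist_comm, dist_comm a, dist_eq_norm, Real.dist_eq, abs_of_nonneg (by linarith)]
    exact hs.norm_sub_le (hs0 ha) hab (hsT b hb) fun t ht => hC _ (hc.out ha hb ht)
  refine LipschitzOnWith.of_dist_le_mul fun a ha b hb => ?_
  rcases le_total a b with h | h
  · exact key a ha b hb h
  · rw [dist_comm, dist_comm a]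
    exact key b hb a ha h

/-- The barriers bound the frequencies and the capacity limits bound the references. Angles and
multipliers are integrals of these quantities, so they grow at most linearly in time. -/
theorem IsSolution.exists_norm_le_of_feasible {T : ℝ} (hs : S.IsSolution T z)
    (hF : ∀ t : ℝ, 0 ≤ t → (t : EReal) < T → S.SafetyFeasible (z t)) :
    ∃ R, ∀ t : ℝ, 0 ≤ t → t < T → ‖z t‖ ≤ R := by
  have hT : 0 < T := by exact_mod_cast hs.pos
  have hlt : ∀ t : ℝ, t < T → (t : EReal) < T := fun t ht => EReal.coe_lt_coe_iff.2 ht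
  obtain ⟨W, hW0, hW⟩ : ∃ W : ℝ, 0 ≤ W ∧ ∀ i, ∀ t : ℝ, 0 ≤ t → t < T → |(z t).freq i| ≤ W := by
    refine ⟨∑ i, (|S.wmin i| + |S.wmax i| + |S.wmin i - (z 0).freq i| +
      |(z 0).freq i - S.wmax i|), by positivity, fun i t ht htT => ?_⟩
    refine le_trans ?_ (Finset.single_le_sum (f := fun i => |S.wmin i| + |S.wmax i| +
      |S.wmin i - (z 0).freq i| + |(z 0).freq i - S.wmax i|) (fun _ _ => by positivity)
      (Finset.mem_univ i))
    obtain ⟨h1, h2⟩ := hs.freq_bounds hF i ht (hlt t htT)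
    have h3 : Real.exp (-(S.β i * t)) ≤ 1 :=
      Real.exp_le_one_iff.2 (by have := S.β_pos i; nlinarith)
    have h4 := mul_le_of_le_one_right (abs_nonneg (S.wmin i - (z 0).freq i)) h3
    have h5 := mul_le_of_le_one_right (abs_nonneg ((z 0).freq i - S.wmax i)) h3
    have h6 := neg_abs_le (S.wmin i)
    have h7 := le_abs_self (S.wmax i)
    have h8 := abs_nonneg (S.wmin i)
    have h9 := abs_nonneg (S.wmax i)
    rw [abs_le]
    constructor <;> linarith [abs_nonneg (S.wmin i - (z 0).freq i),
      abs_nonneg ((z 0).freq i - S.wmax i)]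
  obtain ⟨Q, hQ0, hQ⟩ : ∃ Q : ℝ, 0 ≤ Q ∧ ∀ i, |S.Pmin i| + |S.Pmax i| + |S.d i| ≤ Q :=
    ⟨∑ i, (|S.Pmin i| + |S.Pmax i| + |S.d i|), by positivity, fun i =>
      Finset.single_le_sum (f := fun i => |S.Pmin i| + |S.Pmax i| + |S.d i|)
        (fun _ _ => by positivity) (Finset.mem_univ i)⟩
  have hP : ∀ i, ∀ t : ℝ, 0 ≤ t → t < T → |(z t).genRef i| + |S.d i| ≤ Q := by
    intro i t ht htT
    have h1 := hs.mem t ht (hlt t htT) i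
    have h2 := abs_le_max_abs_abs h1.1 h1.2
    have h3 : max |S.Pmin i| |S.Pmax i| ≤ |S.Pmin i| + |S.Pmax i| :=
      max_le (by linarith [abs_nonneg (S.Pmax i)]) (by linarith [abs_nonneg (S.Pmin i)])
    linarith [hQ i]
  have hint : ∀ {f : PowerState n → ℝ} {v : ℝ → ℝ} {C : ℝ}, IsLipschitz f → 0 ≤ C →
      (∀ t, HasDerivAt z (S.closedLoop (z t)) t → HasDerivAt (fun s => f (z s)) (v t) t) →
      (∀ t : ℝ, 0 ≤ t → t < T → |v t| ≤ C) →
      ∀ t : ℝ, 0 ≤ t → t < T → |f (z t)| ≤ |f (z 0)| + C * T := by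
    intro f v C hf hC hv hvC t ht htT
    have := (hs.absCont_comp hf le_rfl ht (hlt t htT)).abs_sub_le_mul ht (C := C) (by
      filter_upwards [hs.ae_hasDerivAt le_rfl (hlt t htT)] with s hd hm
      exact ⟨_, hv s (hd hm), hvC s hm.1.le (hm.2.trans htT)⟩)
    have h2 := abs_sub_abs_le_abs_sub (f (z t)) (f (z 0))
    have h3 : C * (t - 0) ≤ C * T := mul_le_mul_of_nonneg_left (by linarith) hC
    linarith
  have hz0 := norm_nonneg (z 0)
  have hz0' := (PowerState.norm_le_iff hz0).1 le_rfl
  refine ⟨‖z 0‖ + W + Q + (W + W) * T + Q * T, fun t ht htT => ?_⟩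
  have hWT : 0 ≤ (W + W) * T := by positivity
  have hQT : 0 ≤ Q * T := by positivity
  refine (PowerState.norm_le_iff (by positivity)).2
    ⟨fun i => ?_, fun i => ?_, fun i => ?_, fun i => ?_⟩
  · have := hint ((IsLipschitz.eval i).comp isLipschitz_angle) (add_nonneg hW0 hW0)
      (fun s hd => (hasDerivAt_coord hd).1 i)
      (fun s hs hsT => (abs_sub _ _).trans (add_le_add (hW _ s hs hsT) (hW _ s hs hsT))) t ht htT
    exact this.trans (by linarith [hz0'.1 i])
  · exact (hW i t ht htT).trans (by linarith)
  · have := hP i t ht htT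
    linarith [abs_nonneg (S.d i)]
  · have := hint (isLipschitz_mult i) hQ0
      (fun s hd => (hasDerivAt_coord hd).2.2.2 i)
      (fun s hs hsT => (abs_sub _ _).trans (hP _ s hs hsT)) t ht htT
    exact this.trans (by linarith [hz0'.2.2.2 i])

theorem isClosed_stateSet : IsClosed S.stateSet := by
  have : S.stateSet = ⋂ i, {z : PowerState n | S.Pmin i ≤ z.genRef i ∧ z.genRef i ≤ S.Pmax i} := by
    ext z
    simp [stateSet]
  rw [this]
  exact isClosed_iInter fun i =>
    (isClosed_le continuous_const (isLipschitz_genRef i).continuous).inter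
      (isClosed_le (isLipschitz_genRef i).continuous continuous_const)

theorem exists_norm_closedLoop_le (R : ℝ) :
    ∃ C, 0 ≤ C ∧ ∀ z : PowerState n, ‖z‖ ≤ R → ‖S.closedLoop z‖ ≤ C := by
  obtain ⟨C, hC⟩ := (isCompact_closedBall (0 : PowerState n) R).exists_bound_of_continuousOn
    S.isLipschitz_freeField.continuous.continuousOn
  refine ⟨max C 0, le_max_right _ _, fun z hz => ?_⟩
  exact (S.norm_closedLoop_le z).trans ((hC z (by simpa using hz)).trans (le_max_left _ _))

/-- A bounded solution on a bounded interval extends to a longer interval. -/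
theorem IsSolution.exists_extension (hP : ∀ i, S.Pmin i < S.Pmax i) {T R : ℝ}
    (hs : S.IsSolution T z) (hR : ∀ t : ℝ, 0 ≤ t → t < T → ‖z t‖ ≤ R) :
    ∃ T' > T, ∃ z', S.IsSolution (T' : ℝ) z' ∧ ∀ t : ℝ, 0 ≤ t → t < T → z' t = z t := by
  have hT : 0 < T := by exact_mod_cast hs.pos
  have hlt : ∀ t : ℝ, t < T → (t : EReal) < T := fun t ht => EReal.coe_lt_coe_iff.2 ht
  obtain ⟨C, hC0, hC⟩ := S.exists_norm_closedLoop_le R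
  have hL : LipschitzOnWith C.toNNReal z (Ico 0 T) :=
    hs.lipschitzOnWith (fun t ht => ht.1) ordConnected_Ico (fun t ht => hlt t ht.2) fun t ht => by
      rw [Real.coe_toNNReal C hC0]
      exact hC _ (hR t ht.1 ht.2)
  -- Bounded velocity makes the solution Lipschitz, so it has a limit `g T`, which lies in the
  -- closed state set and serves as the initial state of a local solution.
  obtain ⟨g, hg, hgz⟩ := hL.extend_finite_dimension
  have hgT : g T ∈ S.stateSet := by
    refine isClosed_stateSet.mem_of_tendsto (b := 𝓝[<] T)
      ((hg.continuous.tendsto T).mono_left nhdsWithin_le_nhds) ?_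
    filter_upwards [Ico_mem_nhdsLT hT] with t ht
    rw [← hgz ht]
    exact hs.mem t ht.1 (hlt t ht.2)
  obtain ⟨δ, hδ, K, y, hy0, hyL, hym, hyd⟩ := S.exists_local_solution hP hgT
  set z' : ℝ → PowerState n := fun t => if t < T then z t else y (t - T) with hz'
  have e1 : ∀ t, 0 ≤ t → t < T → z' t = z t := fun t _ ht => if_pos ht
  have e2 : ∀ t, T ≤ t → z' t = y (t - T) := fun t ht => if_neg (not_lt.2 ht)
  obtain ⟨L, hz'L⟩ : ∃ L : NNReal, LipschitzOnWith L z' (Icc 0 (T + δ)) := by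
    refine ⟨_, LipschitzOnWith.glue_Icc (b := T)
      (K := lipschitzExtensionConstant (PowerState n) * C.toNNReal) (L := K)
      (LipschitzOnWith.of_dist_le_mul fun a ha b hb => ?_)
      (LipschitzOnWith.of_dist_le_mul fun a ha b hb => ?_) hT.le (by linarith)⟩
    · have : ∀ t ∈ Icc 0 T, z' t = g t := by
        intro t ht
        rcases ht.2.eq_or_lt with rfl | h
        · rw [e2 t le_rfl, sub_self, hy0]
        · rw [e1 t ht.1 h]
          exact hgz ⟨ht.1, h⟩
      rw [this a ha, this b hb]
      exact hg.dist_le_mul a b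
    · rw [e2 a ha.1, e2 b hb.1]
      have := hyL.dist_le_mul (a - T) ⟨by linarith [ha.1], by linarith [ha.2]⟩ (b - T)
        ⟨by linarith [hb.1], by linarith [hb.2]⟩
      rwa [dist_sub_right] at this
  refine ⟨T + δ, by linarith, z', ⟨?_, ?_, ?_, ?_⟩, e1⟩
  · exact_mod_cast hT.trans (by linarith)
  · intro c hc hcT
    have hcT' : c < T + δ := by exact_mod_cast hcT
    refine LipschitzOnWith.absolutelyContinuousOnInterval (K := L) ?_
    rw [uIcc_of_le hc]
    exact hz'L.mono (Icc_subset_Icc le_rfl hcT'.le)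
  · intro t ht htT
    have htT' : t < T + δ := by exact_mod_cast htT
    rcases lt_or_ge t T with h | h
    · rw [e1 t ht h]
      exact hs.mem t ht (hlt t h)
    · rw [e2 t h]
      exact hym _ ⟨by linarith, by linarith⟩
  · have hne : ∀ᵐ t : ℝ, t ≠ T := by simp [ae_iff]
    have hyd' := ae_comp_add_const hyd (-T)
    filter_upwards [hs.deriv, hyd', hne] with t h1 h2 h3 ht htT
    have htT' : t < T + δ := by exact_mod_cast htT
    rcases lt_or_gt_of_ne h3 with h | h
    · rw [e1 t ht h]
      refine (h1 ht (hlt t h)).congr_of_eventuallyEq ?_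
      filter_upwards [gt_mem_nhds h] with s hs
      exact if_pos hs
    · rw [e2 t h.le]
      have h4 := h2 ⟨by linarith, by linarith⟩
      rw [← sub_eq_add_neg] at h4
      refine (h4.comp_sub_const t T).congr_of_eventuallyEq ?_
      filter_upwards [lt_mem_nhds h] with s hs
      exact e2 s hs.le

/-- Maximal solutions along which the safety programs are feasible are complete. -/
theorem IsMaximalSolution.eq_top_of_feasible (hP : ∀ i, S.Pmin i < S.Pmax i)
    (hs : S.IsMaximalSolution T z)
    (hF : ∀ t : ℝ, 0 ≤ t → (t : EReal) < T → S.SafetyFeasible (z t)) : T = ⊤ := by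
  by_contra hne
  lift T to ℝ using ⟨hne, (bot_lt_iff_ne_bot.1 (bot_le.trans_lt hs.1.pos))⟩
  obtain ⟨R, hR⟩ := hs.1.exists_norm_le_of_feasible hF
  obtain ⟨T', hT', z', hz', he⟩ := hs.1.exists_extension hP hR
  have := hs.2 T' z' hz' (by exact_mod_cast hT'.le)
    (fun t ht htT => he t ht (by exact_mod_cast htT))
  have : T' = T := by exact_mod_cast this
  exact hT'.ne' this

end Solution

end PowerSystem

end

noncomputable section

namespace PowerSystem

open PowerState

variable {n m : ℕ} (S : PowerSystem n m)

/-! ### The network -/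

/-- The difference of a nodal quantity over a tie-line. -/
def edgeDiff (v : Fin (n + 1) → ℝ) (e : Fin m) : ℝ := v (S.src e) - v (S.tgt e)

/-- The angles of all areas relative to the last one. -/
def fullAngle (α : Fin n → ℝ) : Fin (n + 1) → ℝ := Fin.snoc (α := fun _ => ℝ) α 0

@[simp] theorem fullAngle_castSucc (α : Fin n → ℝ) (k : Fin n) :
    fullAngle α k.castSucc = α k := by simp [fullAngle]

@[simp] theorem fullAngle_last (α : Fin n → ℝ) : fullAngle α (Fin.last n) = 0 := by
  simp [fullAngle]

theorem sum_incidence_mul (v : Fin (n + 1) → ℝ) (e : Fin m) :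
    ∑ i, S.incidence i e * v i = S.edgeDiff v e := by
  have h : ∀ i, S.incidence i e * v i =
      (if i = S.src e then v i else 0) - (if i = S.tgt e then v i else 0) := by
    intro i
    have hne := S.src_ne_tgt e
    simp only [incidence, Matrix.of_apply]
    split_ifs with h1 h2
    · exact absurd (h1.symm.trans h2) hne
    all_goals simp
  simp only [h, Finset.sum_sub_distrib, Finset.sum_ite_eq', Finset.mem_univ, if_true, edgeDiff]

theorem reducedIncidence_transpose_mulVec (α : Fin n → ℝ) :
    S.reducedIncidence.transpose.mulVec α = S.edgeDiff (fullAngle α) := by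
  ext e
  rw [← S.sum_incidence_mul, Fin.sum_univ_castSucc]
  simp [Matrix.mulVec, dotProduct, reducedIncidence]

theorem tiePower_apply (α : Fin n → ℝ) (i : Fin (n + 1)) :
    S.tiePower α i = ∑ e, S.incidence i e * (S.B e * S.edgeDiff (fullAngle α) e) := by
  unfold tiePower
  rw [← Matrix.mulVec_mulVec, ← Matrix.mulVec_mulVec, reducedIncidence_transpose_mulVec]
  simp [Matrix.mulVec, dotProduct, Matrix.diagonal_apply]

theorem sum_mul_sum_incidence (v : Fin (n + 1) → ℝ) (y : Fin m → ℝ) :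
    ∑ i, v i * ∑ e, S.incidence i e * (S.B e * y e) = ∑ e, S.B e * S.edgeDiff v e * y e := by
  simp only [Finset.mul_sum]
  rw [Finset.sum_comm]
  refine Finset.sum_congr rfl fun e _ => ?_
  rw [← S.sum_incidence_mul v, Finset.mul_sum, Finset.sum_mul]
  exact Finset.sum_congr rfl fun i _ => by ring

theorem sum_mul_tiePower (v : Fin (n + 1) → ℝ) (α : Fin n → ℝ) :
    ∑ i, v i * S.tiePower α i = ∑ e, S.B e * S.edgeDiff v e * S.edgeDiff (fullAngle α) e := by
  simp only [tiePower_apply, sum_mul_sum_incidence]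

theorem eq_of_edgeDiff_eq_zero {v : Fin (n + 1) → ℝ} (h : ∀ e, S.edgeDiff v e = 0)
    (i j : Fin (n + 1)) : v i = v j := by
  obtain ⟨p⟩ := S.connected.preconnected i j
  induction p with
  | nil => rfl
  | cons hadj _ ih =>
    rw [← ih]
    rw [SimpleGraph.fromRel_adj] at hadj
    rcases hadj.2 with ⟨e, rfl, rfl⟩ | ⟨e, rfl, rfl⟩ <;> have := h e <;> unfold edgeDiff at this <;>
      linarith

theorem eq_zero_of_edgeDiff_eq_zero {α : Fin n → ℝ} (h : ∀ e, S.edgeDiff (fullAngle α) e = 0) :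
    α = 0 := by
  ext k
  have := S.eq_of_edgeDiff_eq_zero h k.castSucc (Fin.last n)
  simpa using this

/-- Pairing the tie-line powers with the full angles gives the sum of the squared angle differences
with weights `B e > 0`. All differences vanish, and connectedness propagates the reference angle 0.
-/
theorem eq_zero_of_tiePower_eq_zero {α : Fin n → ℝ} (h : ∀ i, S.tiePower α i = 0) : α = 0 := by
  refine S.eq_zero_of_edgeDiff_eq_zero fun e => ?_
  have h1 := S.sum_mul_tiePower (fullAngle α) α
  simp only [h, mul_zero, Finset.sum_const_zero] at h1
  have h2 := (Finset.sum_eq_zero_iff_of_nonneg fun e _ => by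
    rw [mul_assoc]
    exact mul_nonneg (S.B_pos e).le (mul_self_nonneg _)).1 h1.symm e (Finset.mem_univ e)
  rw [mul_assoc] at h2
  simpa [(S.B_pos e).ne'] using h2

theorem sum_tiePower (α : Fin n → ℝ) : ∑ i, S.tiePower α i = 0 := by
  have := S.sum_mul_tiePower (fun _ => 1) α
  simpa [edgeDiff] using this

/-! ### The equilibrium -/

/-- The equilibrium of the closed-loop system. -/
def equilibrium : PowerState n := (0, 0, S.d, fun i => -(S.a i * S.d i) - S.b i)

variable {S}

/-- The crux is that the common frequency `c` is 0: the total of generation minus load equals `c`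
times the total damping, yet has sign opposite to `c`. -/
theorem isEquilibrium_iff (hd : ∀ i, S.Pmin i < S.d i ∧ S.d i < S.Pmax i) (z : PowerState n) :
    S.IsEquilibrium z ↔ z = S.equilibrium := by
  constructor
  · rintro ⟨-, hz⟩
    have h1 : ∀ k : Fin n, z.freq k.castSucc - z.freq (Fin.last n) = 0 := fun k =>
      congrFun (congrArg Prod.fst hz) k
    have h2 : ∀ i, S.freqRate z i = 0 := fun i => congrFun (congrArg (·.2.1) hz) i
    have h3 : ∀ i, S.refRate z i = 0 := fun i => congrFun (congrArg (·.2.2.1) hz) i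
    have h4 : ∀ i, z.genRef i = S.d i := fun i =>
      sub_eq_zero.1 (congrFun (congrArg (·.2.2.2) hz) i)
    set c := z.freq (Fin.last n) with hc
    have hw : ∀ i, z.freq i = c := by
      intro i
      induction i using Fin.lastCases with
      | last => rfl
      | cast k => exact sub_eq_zero.1 (h1 k)
    have hgen : ∀ i, S.generation z i = S.D i * c + S.d i + S.tiePower z.angle i := by
      intro i
      have := S.M_mul_freqRate z i
      rw [h2, hw] at this
      linarith
    have hsum : ∑ i, (S.generation z i - S.d i) = (∑ i, S.D i) * c := by
      simp only [hgen]
      rw [Finset.sum_mul, ← add_zero (∑ i, S.D i * c), ← S.sum_tiePower z.angle,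
        ← Finset.sum_add_distrib]
      exact Finset.sum_congr rfl fun i _ => by ring
    have hD : 0 < ∑ i, S.D i := Finset.sum_pos (fun i _ => S.D_pos i) Finset.univ_nonempty
    -- For `c > 0` the lower barrier lies strictly below the generation, so it cannot have raised
    -- it; with the reference equal to the load, clipping can only lower the generation. The case `c
    -- < 0` is symmetric, and for `c = 0` neither barrier binds.
    have hcase : ∀ i, (0 < c → S.generation z i ≤ S.d i) ∧ (c < 0 → S.d i ≤ S.generation z i) ∧
        (c = 0 → S.generation z i = S.d i) := by
      intro i
      have g1 := hgen i
      have g2 := hd i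
      have hβ := mul_pos (S.β_pos i) (S.M_pos i)
      have e1 : S.barrierLower z i = S.generation z i + S.β i * S.M i * (S.wmin i - c) := by
        rw [g1, barrierLower, hw]
      have e2 : S.barrierUpper z i = S.generation z i - S.β i * S.M i * (c - S.wmax i) := by
        rw [g1, barrierUpper, hw]
      have g3 : 0 ≤ c → S.barrierLower z i < S.generation z i := fun h => by
        have := mul_pos hβ (show 0 < c - S.wmin i by linarith [S.wmin_neg i])
        rw [e1]; linarith
      have g4 : c ≤ 0 → S.generation z i < S.barrierUpper z i := fun h => by
        have := mul_pos hβ (show 0 < S.wmax i - c by linarith [S.wmax_pos i])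
        rw [e2]; linarith
      have g5 : S.generation z i = min (max (S.d i) (max (S.Pmin i) (S.barrierLower z i)))
          (min (S.Pmax i) (S.barrierUpper z i)) := by
        rw [generation, h4]
      generalize S.generation z i = G at *
      generalize S.barrierLower z i = l at *
      generalize S.barrierUpper z i = u at *
      clear e1 e2 g1 hsum hgen
      refine ⟨fun h => ?_, fun h => ?_, fun h => ?_⟩
      · have := g3 h.le
        grind
      · have := g4 h.le
        grind
      · have := g3 h.ge
        have := g4 h.le
        grind
    have hc0 : c = 0 := by
      rcases lt_trichotomy c 0 with h | h | h
      · have : 0 ≤ ∑ i, (S.generation z i - S.d i) :=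
          Finset.sum_nonneg fun i _ => sub_nonneg.2 ((hcase i).2.1 h)
        nlinarith
      · exact h
      · have : ∑ i, (S.generation z i - S.d i) ≤ 0 :=
          Finset.sum_nonpos fun i _ => sub_nonpos.2 ((hcase i).1 h)
        nlinarith
    have hα : z.angle = 0 := S.eq_zero_of_tiePower_eq_zero fun i => by
      have := hgen i
      rw [(hcase i).2.2 hc0, hc0] at this
      linarith
    have hξ : ∀ i, z.mult i = -(S.a i * S.d i) - S.b i := by
      intro i
      have := h3 i
      rw [refRate, h4, projBox_of_mem_Ioo (hd i).1 (hd i).2, refDrive, h4, hw, hc0] at this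
      linarith
    refine Prod.ext hα (Prod.ext ?_ (Prod.ext (funext h4) (funext hξ)))
    exact funext fun i => (hw i).trans hc0
  · rintro rfl
    have ht : S.tiePower S.equilibrium.angle = 0 := by
      unfold tiePower
      exact Matrix.mulVec_zero _
    have hg : ∀ i, S.generation S.equilibrium i = S.d i := by
      intro i
      have hβ := mul_pos (S.β_pos i) (S.M_pos i)
      have h1 := mul_neg_of_pos_of_neg hβ (S.wmin_neg i)
      have h2 := mul_pos hβ (S.wmax_pos i)
      have e1 : S.barrierLower S.equilibrium i = S.d i + S.β i * S.M i * S.wmin i := by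
        rw [barrierLower, ht]
        simp [equilibrium, freq]
      have e2 : S.barrierUpper S.equilibrium i = S.d i + S.β i * S.M i * S.wmax i := by
        rw [barrierUpper, ht]
        simp [equilibrium, freq]
      have e3 : S.equilibrium.genRef i = S.d i := rfl
      have := hd i
      rw [generation, e1, e2, e3]
      grind
    refine ⟨fun i => ⟨(hd i).1.le, (hd i).2.le⟩, Prod.ext ?_ (Prod.ext ?_ (Prod.ext ?_ ?_))⟩
    · exact funext fun k => sub_self _
    · refine funext fun i => ?_
      change S.freqRate S.equilibrium i = 0
      rw [freqRate, hg, ht]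
      simp [equilibrium, freq]
    · refine funext fun i => ?_
      change projBox _ _ (S.d i) (-(S.a i * S.d i) - S.b i - (-(S.a i * S.d i) - S.b i) - 0) = 0
      rw [projBox_of_mem_Ioo (hd i).1 (hd i).2]
      ring
    · exact funext fun i => sub_self _

/-! ### The energy function -/

variable (S) in
/-- The energy of the deviation from the equilibrium. -/
def energy (z : PowerState n) : ℝ :=
  ∑ i, (S.M i * z.freq i ^ 2 + (z.genRef i - S.d i) ^ 2 +
    (z.mult i - S.equilibrium.mult i) ^ 2) / 2 +
  ∑ e, S.B e * S.edgeDiff (fullAngle z.angle) e ^ 2 / 2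

theorem isLipschitz_fullAngle (i : Fin (n + 1)) :
    IsLipschitz fun z : PowerState n => fullAngle z.angle i := by
  induction i using Fin.lastCases with
  | last => simpa using .of_const _
  | cast k => simpa using (IsLipschitz.eval k).comp isLipschitz_angle

variable (S) in
theorem isLipschitz_edgeDiff_angle (e : Fin m) :
    IsLipschitz fun z : PowerState n => S.edgeDiff (fullAngle z.angle) e :=
  (isLipschitz_fullAngle _).sub (isLipschitz_fullAngle _)

variable (S) in
theorem isLipschitz_edgeDiff_freq (e : Fin m) :
    IsLipschitz fun z : PowerState n => S.edgeDiff z.freq e :=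
  (isLipschitz_freq _).sub (isLipschitz_freq _)

variable (S) in
theorem continuous_energy : Continuous S.energy := by
  have h1 := fun i => (isLipschitz_freq (n := n) i).continuous
  have h2 := fun i => (isLipschitz_genRef (n := n) i).continuous
  have h3 := fun i => (isLipschitz_mult (n := n) i).continuous
  have h4 := fun e => (S.isLipschitz_edgeDiff_angle e).continuous
  unfold energy
  fun_prop

theorem energy_terms_nonneg (z : PowerState n) :
    (∀ i, 0 ≤ (S.M i * z.freq i ^ 2 + (z.genRef i - S.d i) ^ 2 +
      (z.mult i - S.equilibrium.mult i) ^ 2) / 2) ∧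
    (∀ e, 0 ≤ S.B e * S.edgeDiff (fullAngle z.angle) e ^ 2 / 2) := by
  refine ⟨fun i => ?_, fun e => ?_⟩
  · have := S.M_pos i
    positivity
  · have := S.B_pos e
    positivity

theorem energy_nonneg (z : PowerState n) : 0 ≤ S.energy z :=
  add_nonneg (Finset.sum_nonneg fun i _ => (energy_terms_nonneg z).1 i)
    (Finset.sum_nonneg fun e _ => (energy_terms_nonneg z).2 e)

theorem energy_equilibrium : S.energy S.equilibrium = 0 := by
  have h : ∀ e, S.edgeDiff (fullAngle S.equilibrium.angle) e = 0 := by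
    have : fullAngle S.equilibrium.angle = 0 := by
      ext i
      induction i using Fin.lastCases <;> simp [equilibrium, angle]
    intro e
    simp [this, edgeDiff]
  simp [energy, h]
  simp [equilibrium, freq, genRef]

variable (S) in
-- The transposed reduced incidence matrix is injective by connectedness, hence bounded below in
-- finite dimension.
theorem exists_abs_angle_le :
    ∃ K : ℝ, 0 ≤ K ∧ ∀ (α : Fin n → ℝ) (R : ℝ), 0 ≤ R →
      (∀ e, |S.edgeDiff (fullAngle α) e| ≤ R) → ∀ k, |α k| ≤ K * R := by
  obtain ⟨K, -, hK⟩ := LinearMap.exists_antilipschitzWith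
    (Matrix.mulVecLin S.reducedIncidence.transpose) (by
      rw [LinearMap.ker_eq_bot']
      intro α hα
      rw [Matrix.mulVecLin_apply, reducedIncidence_transpose_mulVec] at hα
      exact S.eq_zero_of_edgeDiff_eq_zero fun e => congrFun hα e)
  refine ⟨K, K.2, fun α R hR h k => ?_⟩
  have h1 := hK.le_mul_dist α 0
  rw [map_zero, dist_zero_right, dist_zero_right, Matrix.mulVecLin_apply,
    reducedIncidence_transpose_mulVec] at h1
  exact (norm_le_pi_norm α k).trans (h1.trans (mul_le_mul_of_nonneg_left
    ((pi_norm_le_iff_of_nonneg hR).2 h) K.2))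

variable (S) in
theorem exists_norm_sub_equilibrium_le :
    ∃ C : ℝ, 0 < C ∧ ∀ z, ‖z - S.equilibrium‖ ≤ C * √(S.energy z) := by
  obtain ⟨K, hK0, hK⟩ := S.exists_abs_angle_le
  set A : ℝ := ∑ i, (S.M i)⁻¹ with hA
  set B : ℝ := ∑ e, (S.B e)⁻¹ with hB
  have hAi : ∀ i, (S.M i)⁻¹ ≤ A := fun i => Finset.single_le_sum (f := fun i => (S.M i)⁻¹)
    (fun i _ => (inv_pos.2 (S.M_pos i)).le) (Finset.mem_univ i)
  have hBe : ∀ e, (S.B e)⁻¹ ≤ B := fun e => Finset.single_le_sum (f := fun e => (S.B e)⁻¹)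
    (fun e _ => (inv_pos.2 (S.B_pos e)).le) (Finset.mem_univ e)
  have hA0 : 0 ≤ A := Finset.sum_nonneg fun i _ => (inv_pos.2 (S.M_pos i)).le
  have hB0 : 0 ≤ B := Finset.sum_nonneg fun i _ => (inv_pos.2 (S.B_pos i)).le
  -- Each squared coordinate is at most twice the energy divided by its weight; the weights are 1,
  -- `M i` and `B e`, and `A`, `B` dominate the inverses.
  set R := √(2 * (1 + A + B)) with hR
  have hR0 : 0 < R := Real.sqrt_pos.2 (by positivity)
  refine ⟨(1 + K) * R, by positivity, fun z => ?_⟩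
  set E := S.energy z with hE
  have hE0 : 0 ≤ E := energy_nonneg z
  have hs0 := Real.sqrt_nonneg E
  have hRE : R * √E = √(2 * (1 + A + B) * E) := (Real.sqrt_mul (by positivity) _).symm
  have hnode : ∀ i, (S.M i * z.freq i ^ 2 + (z.genRef i - S.d i) ^ 2 +
      (z.mult i - S.equilibrium.mult i) ^ 2) / 2 ≤ E := fun i =>
    (Finset.single_le_sum (fun i _ => (energy_terms_nonneg (S := S) z).1 i)
      (Finset.mem_univ i)).trans
    (le_add_of_nonneg_right (Finset.sum_nonneg fun e _ => (energy_terms_nonneg z).2 e))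
  have hedge : ∀ e, S.B e * S.edgeDiff (fullAngle z.angle) e ^ 2 / 2 ≤ E := fun e =>
    (Finset.single_le_sum (fun i _ => (energy_terms_nonneg (S := S) z).2 i)
      (Finset.mem_univ e)).trans
    (le_add_of_nonneg_left (Finset.sum_nonneg fun e _ => (energy_terms_nonneg z).1 e))
  have hAE : 0 ≤ A * E := mul_nonneg hA0 hE0
  have hBE : 0 ≤ B * E := mul_nonneg hB0 hE0
  have hle : ∀ x : ℝ, x ^ 2 ≤ 2 * (1 + A + B) * E → |x| ≤ R * √E := fun x hx => by
    rw [hRE]; exact Real.abs_le_sqrt hx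
  have hRs : 0 ≤ R * √E := by positivity
  have hKR : R * √E ≤ (1 + K) * R * √E := by nlinarith [mul_nonneg hK0 hRs]
  refine (PowerState.norm_le_iff (by positivity)).2
    ⟨fun k => ?_, fun i => ?_, fun i => ?_, fun i => ?_⟩
  · have h1 : ∀ e, |S.edgeDiff (fullAngle z.angle) e| ≤ R * √E := by
      intro e
      refine hle _ ?_
      have h2 : S.edgeDiff (fullAngle z.angle) e ^ 2 ≤ (S.B e)⁻¹ * (2 * E) := by
        rw [← div_eq_inv_mul, le_div_iff₀ (S.B_pos e)]
        linarith [hedge e]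
      nlinarith [hBe e]
    have h3 := hK z.angle _ hRs h1 k
    have h4 : (z - S.equilibrium).angle k = z.angle k := sub_zero _
    rw [h4]
    nlinarith
  · refine (hle _ ?_).trans hKR
    have h4 : (z - S.equilibrium).freq i = z.freq i := sub_zero _
    rw [h4]
    have h2 : z.freq i ^ 2 ≤ (S.M i)⁻¹ * (2 * E) := by
      rw [← div_eq_inv_mul, le_div_iff₀ (S.M_pos i)]
      linarith [hnode i, sq_nonneg (z.genRef i - S.d i), sq_nonneg (z.mult i - S.equilibrium.mult i)]
    nlinarith [hAi i]
  · refine (hle _ ?_).trans hKR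
    have h4 : (z - S.equilibrium).genRef i = z.genRef i - S.d i := rfl
    rw [h4]
    have := mul_nonneg (S.M_pos i).le (sq_nonneg (z.freq i))
    nlinarith [hnode i, sq_nonneg (z.mult i - S.equilibrium.mult i)]
  · refine (hle _ ?_).trans hKR
    have h4 : (z - S.equilibrium).mult i = z.mult i - S.equilibrium.mult i := rfl
    rw [h4]
    have := mul_nonneg (S.M_pos i).le (sq_nonneg (z.freq i))
    nlinarith [hnode i, sq_nonneg (z.genRef i - S.d i)]

section Solution

variable {T : EReal} {z : ℝ → PowerState n}

theorem hasDerivAt_fullAngle {t : ℝ} (h : HasDerivAt z (S.closedLoop (z t)) t)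
    (i : Fin (n + 1)) : HasDerivAt (fun s => fullAngle (z s).angle i)
      ((z t).freq i - (z t).freq (Fin.last n)) t := by
  induction i using Fin.lastCases with
  | last => simpa using hasDerivAt_const t (0 : ℝ)
  | cast k => simpa using (hasDerivAt_coord h).1 k

theorem hasDerivAt_edgeDiff_angle {t : ℝ} (h : HasDerivAt z (S.closedLoop (z t)) t)
    (e : Fin m) : HasDerivAt (fun s => S.edgeDiff (fullAngle (z s).angle) e)
      (S.edgeDiff (z t).freq e) t := by
  have := (hasDerivAt_fullAngle h (S.src e)).sub (hasDerivAt_fullAngle h (S.tgt e))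
  rw [sub_sub_sub_cancel_right] at this
  exact this

/-- The energy balance. -/
theorem exists_hasDerivAt_energy (hd : ∀ i, S.Pmin i < S.d i ∧ S.d i < S.Pmax i) {t : ℝ}
    (h : HasDerivAt z (S.closedLoop (z t)) t) :
    ∃ E', HasDerivAt (fun s => S.energy (z s)) E' t ∧
      E' ≤ ∑ i, (-(S.D i * (z t).freq i ^ 2) - S.a i * ((z t).genRef i - S.d i) ^ 2 +
        (z t).freq i * (S.generation (z t) i - (z t).genRef i)) := by
  obtain ⟨-, h2, h3, h4⟩ := hasDerivAt_coord h
  have hnode := fun i => (((((h2 i).pow 2).const_mul (S.M i)).add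
    (((h3 i).sub_const (S.d i)).pow 2)).add
    (((h4 i).sub_const (S.equilibrium.mult i)).pow 2)).div_const 2
  have hedge := fun e => (((hasDerivAt_edgeDiff_angle h e).pow 2).const_mul (S.B e)).div_const 2
  refine ⟨_, (HasDerivAt.fun_sum fun i _ => hnode i).add
    (HasDerivAt.fun_sum fun e _ => hedge e), ?_⟩
  have hid := S.sum_mul_tiePower (z t).freq (z t).angle
  have he : ∑ e, S.B e * (((2 : ℕ) : ℝ) * S.edgeDiff (fullAngle (z t).angle) e ^ (2 - 1) *
      S.edgeDiff (z t).freq e) / 2 = ∑ i, (z t).freq i * S.tiePower (z t).angle i := by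
    rw [hid]
    refine Finset.sum_congr rfl fun e _ => ?_
    norm_num
    ring
  rw [he, ← Finset.sum_add_distrib]
  refine Finset.sum_le_sum fun i _ => ?_
  -- The load is an admissible test point, so the projection only helps the decay.
  have hq := sub_mul_projBox_le (x := (z t).genRef i) ⟨(hd i).1.le, (hd i).2.le⟩
    (S.refDrive (z t) i)
  have hM := S.M_mul_freqRate (z t) i
  have hm : S.equilibrium.mult i = -(S.a i * S.d i) - S.b i := rfl
  change _ * S.refRate (z t) i ≤ _ at hq
  rw [refDrive] at hq
  norm_num
  rw [hm]
  have hM' : S.M i * (2 * (z t).freq i * S.freqRate (z t) i) = 2 * (z t).freq i *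
      (-(S.D i * (z t).freq i) + S.generation (z t) i - S.d i - S.tiePower (z t).angle i) := by
    rw [← hM]; ring
  rw [hM']
  linarith

theorem IsSolution.absCont_mul (hs : S.IsSolution T z) {f g : PowerState n → ℝ}
    (hf : IsLipschitz f) (hg : IsLipschitz g) {a b : ℝ} (ha : 0 ≤ a) (hab : a ≤ b)
    (hb : (b : EReal) < T) :
    AbsolutelyContinuousOnInterval (fun t => f (z t) * g (z t)) a b :=
  (hs.absCont_comp hf ha hab hb).mul (hs.absCont_comp hg ha hab hb)

theorem IsSolution.absCont_energy (hs : S.IsSolution T z) {a b : ℝ} (ha : 0 ≤ a) (hab : a ≤ b)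
    (hb : (b : EReal) < T) : AbsolutelyContinuousOnInterval (fun t => S.energy (z t)) a b := by
  have hsq : ∀ {f : PowerState n → ℝ}, IsLipschitz f →
      AbsolutelyContinuousOnInterval (fun t => f (z t) ^ 2) a b := fun hf => by
    simp only [pow_two]
    exact hs.absCont_mul hf hf ha hab hb
  refine (AbsolutelyContinuousOnInterval.fun_sum _ fun i _ => ?_).add
    (AbsolutelyContinuousOnInterval.fun_sum _ fun e _ => ?_)
  · simp only [div_eq_inv_mul]
    exact ((((hsq (isLipschitz_freq i)).const_mul _).add
      (hsq ((isLipschitz_genRef i).sub (.of_const _)))).add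
      (hsq ((isLipschitz_mult i).sub (.of_const _)))).const_mul _
  · simp only [div_eq_inv_mul]
    exact ((hsq (S.isLipschitz_edgeDiff_angle e)).const_mul _).const_mul _

end Solution

end PowerSystem

end

noncomputable section

namespace PowerSystem

open PowerState

variable {n m : ℕ} (S : PowerSystem n m)

/-! ### The energy of the velocity -/

/-- The correction of the generation reference by the safety program. -/
def correction (z : PowerState n) (i : Fin (n + 1)) : ℝ := S.generation z i - z.genRef i

theorem isLipschitz_correction (i : Fin (n + 1)) : IsLipschitz fun z => S.correction z i :=
  (S.isLipschitz_generation i).sub (isLipschitz_genRef i)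

/-- The part of the energy of the velocity that is continuous along solutions, corrected by the
power that the safety programs exchange with the frequency dynamics. -/
def velocityEnergy (z : PowerState n) : ℝ :=
  ∑ i, (S.M i * S.freqRate z i ^ 2 / 2 - S.freqRate z i * S.correction z i +
    (z.genRef i - S.d i) ^ 2 / 2) + ∑ e, S.B e * S.edgeDiff z.freq e ^ 2 / 2

variable {S}

/-- The safety program works against the frequency deviation, up to the violation `e` of the
frequency bounds. -/
theorem correction_spec {z : PowerState n} (hz : z ∈ S.stateSet) (hF : S.SafetyFeasible z)
    (i : Fin (n + 1)) {e : ℝ} (he : 0 ≤ e) (h1 : S.wmin i - z.freq i ≤ e)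
    (h2 : z.freq i - S.wmax i ≤ e) :
    0 ≤ -(S.freqRate z i * S.correction z i) + (S.Pmax i - S.Pmin i) * S.β i * e ∧
    ∀ g, 0 ≤ g → g ≤ S.β i ^ 2 →
      g * (z.freq i * S.correction z i) + S.β i * S.freqRate z i * S.correction z i ≤
        (S.Pmax i - S.Pmin i) * S.β i ^ 2 * e := by
  obtain ⟨⟨hg1, hg2⟩, -, -, -⟩ := S.generation_spec hz hF i
  obtain ⟨-, hlo, hup⟩ := S.freqRate_spec hz hF i
  have hβ := S.β_pos i
  have hwn := S.wmin_neg i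
  have hwx := S.wmax_pos i
  obtain ⟨hz1, hz2⟩ := hz i
  have hc : S.correction z i = S.generation z i - z.genRef i := rfl
  set c := S.correction z i with hcdef
  set C := S.Pmax i - S.Pmin i with hC
  have hC0 : 0 ≤ C := by linarith
  rcases lt_trichotomy c 0 with h | h | h
  · rw [hup (by linarith)]
    have hcC : -c ≤ C := by linarith
    have hce : (-c) * e ≤ C * e := mul_le_mul_of_nonneg_right hcC he
    have h3 : (-c) * (z.freq i - S.wmax i) ≤ (-c) * e :=
      mul_le_mul_of_nonneg_left h2 (by linarith)
    refine ⟨?_, fun g hg hgβ => ?_⟩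
    · have := mul_le_mul_of_nonneg_left (h3.trans hce) hβ.le
      linarith
    -- Inserting ω = β (wmax - w), the left side of the goal becomes (β² - g)(-c)(w - wmax) - g (-c)
    -- wmax: the last term is favourable, and the first needs g ≤ β².
    · have h4 : (S.β i ^ 2 - g) * ((-c) * (z.freq i - S.wmax i)) ≤ (S.β i ^ 2 - g) * (C * e) :=
        mul_le_mul_of_nonneg_left (h3.trans hce) (by linarith)
      have h5 : 0 ≤ g * (C * e) := by positivity
      have h6 : 0 ≤ g * ((-c) * S.wmax i) := mul_nonneg hg (mul_nonneg (by linarith) hwx.le)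
      linarith
  · rw [h]
    simp only [mul_zero, neg_zero, zero_add, add_zero]
    exact ⟨by positivity, fun g _ _ => by positivity⟩
  · rw [hlo (by linarith)]
    have hcC : c ≤ C := by linarith
    have hce : c * e ≤ C * e := mul_le_mul_of_nonneg_right hcC he
    have h3 : c * (S.wmin i - z.freq i) ≤ c * e := mul_le_mul_of_nonneg_left h1 h.le
    refine ⟨?_, fun g hg hgβ => ?_⟩
    · have := mul_le_mul_of_nonneg_left (h3.trans hce) hβ.le
      linarith
    · have h4 : (S.β i ^ 2 - g) * (c * (S.wmin i - z.freq i)) ≤ (S.β i ^ 2 - g) * (C * e) :=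
        mul_le_mul_of_nonneg_left (h3.trans hce) (by linarith)
      have h5 : 0 ≤ g * (C * e) := by positivity
      have h6 : 0 ≤ g * (c * (-S.wmin i)) := mul_nonneg hg (mul_nonneg h.le (by linarith))
      linarith

section Solution

variable {T : EReal} {z : ℝ → PowerState n}

theorem hasDerivAt_tiePower {t : ℝ} (h : HasDerivAt z (S.closedLoop (z t)) t)
    (i : Fin (n + 1)) : HasDerivAt (fun s => S.tiePower (z s).angle i)
      (∑ e, S.incidence i e * (S.B e * S.edgeDiff (z t).freq e)) t := by
  simp only [tiePower_apply]
  exact HasDerivAt.fun_sum fun e _ =>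
    ((hasDerivAt_edgeDiff_angle h e).const_mul _).const_mul _

/-- While the safety program of area `i` corrects the reference, the frequency relaxes linearly to
one of its bounds. -/
theorem mul_correction_eq_of_hasDerivAt {t : ℝ} (h : HasDerivAt z (S.closedLoop (z t)) t)
    (hF : ∀ᶠ s in 𝓝 t, z s ∈ S.stateSet ∧ S.SafetyFeasible (z s)) (i : Fin (n + 1)) {ω' : ℝ}
    (hω : HasDerivAt (fun s => S.freqRate (z s) i) ω' t) :
    ω' * S.correction (z t) i = -(S.β i * S.freqRate (z t) i * S.correction (z t) i) := by
  have hcont : ContinuousAt (fun s => S.correction (z s) i) t :=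
    (S.isLipschitz_correction i).continuous.continuousAt.comp h.continuousAt
  have hw := (hasDerivAt_coord h).2.1 i
  rcases lt_trichotomy (S.correction (z t) i) 0 with h0 | h0 | h0
  -- The strict sign of the correction persists near `t`, so there ω coincides with β (wmax - w),
  -- whose derivative is -β ω.
  · have hd := ((hasDerivAt_const t (S.wmax i)).sub hw).const_mul (S.β i)
    have : ω' = S.β i * (0 - S.freqRate (z t) i) := by
      refine hω.unique (hd.congr_of_eventuallyEq ?_)
      filter_upwards [hF, hcont.eventually_lt_const h0] with s hs hc
      exact (S.freqRate_spec hs.1 hs.2 i).2.2 (sub_neg.1 hc)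
    rw [this]; ring
  · simp [h0]
  · have hd := ((hasDerivAt_const t (S.wmin i)).sub hw).const_mul (S.β i)
    have : ω' = S.β i * (0 - S.freqRate (z t) i) := by
      refine hω.unique (hd.congr_of_eventuallyEq ?_)
      filter_upwards [hF, hcont.eventually_const_lt h0] with s hs hc
      exact (S.freqRate_spec hs.1 hs.2 i).2.1 (sub_pos.1 hc)
    rw [this]; ring

/-- The balance of the energy of the velocity. -/
theorem hasDerivAt_velocityEnergy {t : ℝ} (h : HasDerivAt z (S.closedLoop (z t)) t)
    (hF : ∀ᶠ s in 𝓝 t, z s ∈ S.stateSet ∧ S.SafetyFeasible (z s))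
    (hω : ∀ i, DifferentiableAt ℝ (fun s => S.freqRate (z s) i) t)
    (hc : ∀ i, DifferentiableAt ℝ (fun s => S.correction (z s) i) t) :
    HasDerivAt (fun s => S.velocityEnergy (z s))
      (∑ i, (-(S.D i * S.freqRate (z t) i ^ 2) + S.freqRate (z t) i * S.refRate (z t) i +
        S.β i * S.freqRate (z t) i * S.correction (z t) i +
        ((z t).genRef i - S.d i) * S.refRate (z t) i)) t := by
  obtain ⟨-, h2, h3, h4⟩ := hasDerivAt_coord h
  have hω := fun i => (hω i).hasDerivAt
  have hc := fun i => (hc i).hasDerivAt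
  have hnode := fun i => (((((hω i).pow 2).const_mul (S.M i)).div_const 2).sub
    ((hω i).mul (hc i))).add ((((h3 i).sub_const (S.d i)).pow 2).div_const 2)
  have hedge := fun e => (((((h2 (S.src e)).sub (h2 (S.tgt e))).pow 2).const_mul
    (S.B e)).div_const 2)
  -- The swing equation differentiated in time, with the generation split into correction plus
  -- reference.
  have hbal : ∀ i, S.M i * deriv (fun s => S.freqRate (z s) i) t =
      -(S.D i * S.freqRate (z t) i) + (deriv (fun s => S.correction (z s) i) t +
        S.refRate (z t) i) - ∑ e, S.incidence i e * (S.B e * S.edgeDiff (z t).freq e) := by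
    intro i
    have e1 := (hω i).const_mul (S.M i)
    have e2 := ((((h2 i).const_mul (S.D i)).neg.add ((hc i).add (h3 i))).sub_const (S.d i)).sub
      (hasDerivAt_tiePower h i)
    refine e1.unique (e2.congr_of_eventuallyEq (Eventually.of_forall fun s => ?_))
    simp only [Pi.add_apply, Pi.sub_apply, Pi.neg_apply, M_mul_freqRate, correction,
      sub_add_cancel]
  refine ((HasDerivAt.fun_sum fun i _ => hnode i).add
    (HasDerivAt.fun_sum fun e _ => hedge e)).congr_deriv ?_
  have he : ∑ e, S.B e * (((2 : ℕ) : ℝ) * (((fun s => (z s).freq (S.src e)) -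
      fun s => (z s).freq (S.tgt e)) t) ^ (2 - 1) *
      (S.freqRate (z t) (S.src e) - S.freqRate (z t) (S.tgt e))) / 2 =
      ∑ i, S.freqRate (z t) i * ∑ e, S.incidence i e * (S.B e * S.edgeDiff (z t).freq e) := by
    rw [S.sum_mul_sum_incidence]
    refine Finset.sum_congr rfl fun e _ => ?_
    norm_num [edgeDiff]
    ring
  rw [he, ← Finset.sum_add_distrib]
  refine Finset.sum_congr rfl fun i _ => ?_
  have hi := mul_correction_eq_of_hasDerivAt h hF i (hω i)
  norm_num
  linear_combination S.freqRate (z t) i * hbal i - hi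

theorem IsSolution.absCont_velocityEnergy (hs : S.IsSolution T z) {a b : ℝ} (ha : 0 ≤ a)
    (hab : a ≤ b) (hb : (b : EReal) < T) :
    AbsolutelyContinuousOnInterval (fun t => S.velocityEnergy (z t)) a b := by
  have hsq : ∀ {f : PowerState n → ℝ}, IsLipschitz f →
      AbsolutelyContinuousOnInterval (fun t => f (z t) ^ 2) a b := fun hf => by
    simp only [pow_two]
    exact hs.absCont_mul hf hf ha hab hb
  refine (AbsolutelyContinuousOnInterval.fun_sum _ fun i _ => ?_).add
    (AbsolutelyContinuousOnInterval.fun_sum _ fun e _ => ?_)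
  · simp only [div_eq_inv_mul]
    exact ((((hsq (S.isLipschitz_freqRate i)).const_mul _).const_mul _).sub
      (hs.absCont_mul (S.isLipschitz_freqRate i) (S.isLipschitz_correction i) ha hab hb)).add
      ((hsq ((isLipschitz_genRef i).sub (.of_const _))).const_mul _)
  · simp only [div_eq_inv_mul]
    exact ((hsq (S.isLipschitz_edgeDiff_freq e)).const_mul _).const_mul _

theorem IsSolution.continuousOn (hs : S.IsSolution T z) {a b : ℝ} (ha : 0 ≤ a) (hab : a ≤ b)
    (hb : (b : EReal) < T) : ContinuousOn z (Icc a b) := by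
  have := ((hs.absCont b (ha.trans hab) hb).mono_Icc ha hab le_rfl).continuousOn
  rwa [uIcc_of_le hab] at this

theorem IsSolution.exists_lipschitzOnWith (hs : S.IsSolution T z) {b : ℝ} (hb0 : 0 ≤ b)
    (hb : (b : EReal) < T) : ∃ C : NNReal, LipschitzOnWith C z (Icc 0 b) ∧
      ∀ t ∈ Icc 0 b, ‖S.closedLoop (z t)‖ ≤ C := by
  obtain ⟨R, hR⟩ := isCompact_Icc.exists_bound_of_continuousOn (hs.continuousOn le_rfl hb0 hb)
  obtain ⟨C, hC0, hC⟩ := S.exists_norm_closedLoop_le R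
  refine ⟨⟨C, hC0⟩, hs.lipschitzOnWith (fun t ht => ht.1) ordConnected_Icc
    (fun t ht => (EReal.coe_le_coe_iff.2 ht.2).trans_lt hb) fun t ht => hC _ (hR t ht),
    fun t ht => hC _ (hR t ht)⟩

theorem abs_refRate_le (z : PowerState n) (i : Fin (n + 1)) :
    |S.refRate z i| ≤ ‖S.closedLoop z‖ :=
  ((PowerState.norm_le_iff (z := S.closedLoop z) (norm_nonneg _)).1 le_rfl).2.2.1 i

/-- The decay of the squared speed of the generation reference of area `i`. -/
theorem IsSolution.refRate_sq_sub_le (hs : S.IsSolution ⊤ z) (i : Fin (n + 1)) {s t : ℝ}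
    (hs0 : 0 ≤ s) (hst : s ≤ t) (hds : HasDerivAt z (S.closedLoop (z s)) s)
    (hdt : HasDerivAt z (S.closedLoop (z t)) t) :
    IntervalIntegrable (fun τ => S.refRate (z τ) i * (-(S.a i * S.refRate (z τ) i) -
      ((z τ).genRef i - S.d i + S.freqRate (z τ) i))) volume s t ∧
    S.refRate (z t) i ^ 2 / 2 - S.refRate (z s) i ^ 2 / 2 ≤
      ∫ τ in s..t, S.refRate (z τ) i * (-(S.a i * S.refRate (z τ) i) -
        ((z τ).genRef i - S.d i + S.freqRate (z τ) i)) := by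
  have hlt : ∀ b : ℝ, (b : EReal) < ⊤ := EReal.coe_lt_top
  obtain ⟨C, hL, hC⟩ := hs.exists_lipschitzOnWith (b := t + 1) (by linarith) (hlt _)
  have hsub : Icc s (t + 1) ⊆ Icc 0 (t + 1) := Icc_subset_Icc hs0 le_rfl
  have hcomp : ∀ {f : PowerState n → ℝ}, IsLipschitz f →
      ∃ K : NNReal, LipschitzOnWith K (fun τ => f (z τ)) (Icc s (t + 1)) := fun hf =>
    ⟨_, hf.choose_spec.comp_lipschitzOnWith (hL.mono hsub)⟩
  obtain ⟨K, hK⟩ := hcomp (isLipschitz_genRef i)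
  obtain ⟨K', hK'⟩ := hcomp (((IsLipschitz.of_const (S.b i)).add (isLipschitz_mult i)).add
    (isLipschitz_freq i))
  have hd := hs.ae_hasDerivAt hs0 (hlt (t + 1))
  have hder : ∀ τ, HasDerivAt z (S.closedLoop (z τ)) τ →
      HasDerivAt (fun τ => S.b i + (z τ).mult i + (z τ).freq i)
        ((z τ).genRef i - S.d i + S.freqRate (z τ) i) τ := fun τ h =>
    (((hasDerivAt_coord h).2.2.2 i).const_add (S.b i)).add ((hasDerivAt_coord h).2.1 i)
  constructor
  · have hcont : ContinuousOn (fun τ => (z τ).genRef i - S.d i + S.freqRate (z τ) i) (Icc s t) :=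
      (((isLipschitz_genRef i).sub (.of_const _)).add
        (S.isLipschitz_freqRate i)).continuous.comp_continuousOn
        (hs.continuousOn hs0 hst (hlt t))
    -- The projection is discontinuous, so measurability comes from agreement almost everywhere with
    -- a derivative.
    have hqm : AEStronglyMeasurable (fun τ => S.refRate (z τ) i) (volume.restrict (Icc s t)) := by
      refine (measurable_deriv (fun τ => (z τ).genRef i)).aestronglyMeasurable.congr ?_
      refine ae_restrict_Icc_of_ae_Ioo ?_
      filter_upwards [hd] with τ h hτ
      exact ((hasDerivAt_coord (h ⟨hτ.1, by linarith [hτ.2]⟩)).2.2.1 i).deriv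
    obtain ⟨R, hR⟩ := isCompact_Icc.exists_bound_of_continuousOn hcont
    rw [intervalIntegrable_iff_integrableOn_Icc_of_le hst]
    refine Integrable.of_bound (hqm.mul ((hqm.const_mul _).neg.sub
      (hcont.aestronglyMeasurable measurableSet_Icc))) (C * (|S.a i| * C + R)) ?_
    filter_upwards [ae_restrict_mem measurableSet_Icc] with τ hτ
    have hq : |S.refRate (z τ) i| ≤ C :=
      (abs_refRate_le _ i).trans (hC τ ⟨hs0.trans hτ.1, by linarith [hτ.2]⟩)
    rw [Real.norm_eq_abs, abs_mul]
    refine mul_le_mul hq ((abs_sub _ _).trans (add_le_add ?_ (hR τ hτ))) (abs_nonneg _) C.2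
    rw [abs_neg, abs_mul]
    exact mul_le_mul_of_nonneg_left hq (abs_nonneg _)
  · refine projBox_speed_sq_sub_le (q := fun τ => S.refRate (z τ) i)
      (v := fun τ => (z τ).genRef i - S.d i + S.freqRate (z τ) i) (a := S.a i) hst hK hK'
      (fun τ hτ => hs.mem τ (hs0.trans hτ.1) (hlt τ) i) (fun τ => ?_) ?_ ?_
      ((hasDerivAt_coord hds).2.2.1 i) ((hasDerivAt_coord hdt).2.2.1 i)
    · simp only [refRate, refDrive]
      congr 1
      ring
    · filter_upwards [hd] with τ h hτ
      exact (hasDerivAt_coord (h hτ)).2.2.1 i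
    · filter_upwards [hd] with τ h hτ
      exact hder τ (h hτ)

end Solution

end PowerSystem

end

noncomputable section

namespace PowerSystem

open PowerState

variable {n m : ℕ} (S : PowerSystem n m)

/-! ### Convergence of feasible solutions -/

/-- The power dissipated by the damping and the generation costs. -/
def dissipation (z : PowerState n) : ℝ :=
  ∑ i, (S.D i * z.freq i ^ 2 + S.a i * (z.genRef i - S.d i) ^ 2)

theorem continuous_dissipation : Continuous S.dissipation := by
  have h1 := fun i => (isLipschitz_freq (n := n) i).continuous
  have h2 := fun i => (isLipschitz_genRef (n := n) i).continuous
  unfold dissipation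
  fun_prop

variable {S}

theorem dissipation_term_nonneg (z : PowerState n) (i : Fin (n + 1)) :
    0 ≤ S.D i * z.freq i ^ 2 + S.a i * (z.genRef i - S.d i) ^ 2 := by
  have := S.D_pos i
  have := S.a_pos i
  positivity

theorem dissipation_nonneg (z : PowerState n) : 0 ≤ S.dissipation z :=
  Finset.sum_nonneg fun i _ => dissipation_term_nonneg z i

variable {z : ℝ → PowerState n}

/-- The functional is g times the energy, plus the velocity energy, plus exponentials paying for the
initial violation of the frequency bounds, plus Σ q²/2. The cross terms of q with ω and with the
reference deviation cancel between the last summand and the velocity energy. Monotonicity is claimed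
only between differentiability times, because q may jump. -/
theorem IsSolution.exists_lyapunov (hd : ∀ i, S.Pmin i < S.d i ∧ S.d i < S.Pmax i)
    (hs : S.IsSolution ⊤ z) (hF : ∀ t, 0 ≤ t → S.SafetyFeasible (z t)) :
    ∃ g > 0, ∃ Λ : ℝ → ℝ, (∀ t, 0 ≤ t → g * S.energy (z t) ≤ Λ t) ∧
      ∀ s t, 0 < s → s ≤ t → HasDerivAt z (S.closedLoop (z s)) s →
        HasDerivAt z (S.closedLoop (z t)) t →
        Λ t + ∫ τ in s..t, g * S.dissipation (z τ) ≤ Λ s := by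
  have hlt : ∀ b : ℝ, (b : EReal) < ⊤ := EReal.coe_lt_top
  have hmem : ∀ t, 0 ≤ t → z t ∈ S.stateSet := fun t ht => hs.mem t ht (hlt t)
  -- One weight must serve all areas for the tie-line terms to cancel in the energy balance, so g is
  -- the least β².
  obtain ⟨i₀, hi₀⟩ := Finite.exists_min fun i => S.β i ^ 2
  set g := S.β i₀ ^ 2 with hg
  have hg0 : 0 < g := pow_pos (S.β_pos i₀) 2
  set κ : Fin (n + 1) → ℝ := fun i => |S.wmin i - (z 0).freq i| + |(z 0).freq i - S.wmax i|
  have hκ : ∀ i, 0 ≤ κ i := fun i => by positivity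
  set e : Fin (n + 1) → ℝ → ℝ := fun i t => κ i * Real.exp (-(S.β i * t)) with he
  have he0 : ∀ i t, 0 ≤ e i t := fun i t => mul_nonneg (hκ i) (Real.exp_pos _).le
  have hspec : ∀ (i : Fin (n + 1)) (t : ℝ), 0 ≤ t → _ := fun i t ht =>
    correction_spec (hmem t ht) (hF t ht) i (he0 i t)
      (((hs.freq_bounds (fun t ht _ => hF t ht) i ht (hlt t)).1).trans
        (mul_le_mul_of_nonneg_right (by simp only [κ]; linarith [abs_nonneg ((z 0).freq i - S.wmax i)])
          (Real.exp_pos _).le))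
      (((hs.freq_bounds (fun t ht _ => hF t ht) i ht (hlt t)).2).trans
        (mul_le_mul_of_nonneg_right (by simp only [κ]; linarith [abs_nonneg (S.wmin i - (z 0).freq i)])
          (Real.exp_pos _).le))
  set Λ : ℝ → ℝ := fun t => g * S.energy (z t) + S.velocityEnergy (z t) +
    ∑ i, (S.Pmax i - S.Pmin i) * S.β i * e i t with hΛ
  have hΛ0 : ∀ t, 0 ≤ t → g * S.energy (z t) ≤ Λ t := by
    intro t ht
    have h1 : 0 ≤ S.velocityEnergy (z t) + ∑ i, (S.Pmax i - S.Pmin i) * S.β i * e i t := by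
      unfold velocityEnergy
      rw [add_right_comm, ← Finset.sum_add_distrib]
      refine add_nonneg (Finset.sum_nonneg fun i _ => ?_) (Finset.sum_nonneg fun e _ => ?_)
      · have h2 := (hspec i t ht).1
        have h3 := mul_nonneg (S.M_pos i).le (sq_nonneg (S.freqRate (z t) i))
        have h4 := sq_nonneg ((z t).genRef i - S.d i)
        linarith
      · have := S.B_pos e
        positivity
    simp only [hΛ]
    linarith
  refine ⟨g, hg0, fun t => Λ t + ∑ i, S.refRate (z t) i ^ 2 / 2, fun t ht =>
    (hΛ0 t ht).trans (le_add_of_nonneg_right (Finset.sum_nonneg fun i _ => by positivity)), ?_⟩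
  intro s t hs0 hst hds hdt
  have hq := fun i => hs.refRate_sq_sub_le i hs0.le hst hds hdt
  set h : Fin (n + 1) → ℝ → ℝ := fun i τ => S.refRate (z τ) i * (-(S.a i * S.refRate (z τ) i) -
    ((z τ).genRef i - S.d i + S.freqRate (z τ) i)) with hh
  have hdi : IntervalIntegrable (fun τ => g * S.dissipation (z τ)) volume s t := by
    refine ContinuousOn.intervalIntegrable ?_
    rw [uIcc_of_le hst]
    exact (continuous_const.mul S.continuous_dissipation).comp_continuousOn
      (hs.continuousOn hs0.le hst (hlt t))
  have hdn : IntervalIntegrable (fun τ => -(g * S.dissipation (z τ))) volume s t := hdi.neg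
  have hhi : IntervalIntegrable (fun τ => ∑ i, h i τ) volume s t := by
    have := IntervalIntegrable.sum (f := h) Finset.univ fun i _ => (hq i).1
    simpa only [Finset.sum_fn] using this
  have hac : AbsolutelyContinuousOnInterval Λ s t :=
    (((hs.absCont_energy hs0.le hst (hlt t)).const_mul g).add
      (hs.absCont_velocityEnergy hs0.le hst (hlt t))).add
      (AbsolutelyContinuousOnInterval.fun_sum _ fun i _ =>
        ContDiffOn.absolutelyContinuousOnInterval (by fun_prop))
  have hdiff : ∀ {f : PowerState n → Fin (n + 1) → ℝ}, (∀ i, IsLipschitz fun z => f z i) →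
      ∀ᵐ τ : ℝ, ∀ i, τ ∈ uIcc s t → DifferentiableAt ℝ (fun τ => f (z τ) i) τ := fun hf =>
    ae_all_iff.2 fun i => (hs.absCont_comp (hf i) hs0.le hst (hlt t)).ae_differentiableAt
  -- The absolutely continuous part is integrated here. Its remainder `-h` is cancelled below by the
  -- integral estimate for q²/2.
  have key : Λ t - Λ s ≤ ∫ τ in s..t, (-(g * S.dissipation (z τ)) - ∑ i, h i τ) := by
    refine hac.sub_le_integral hst (hdn.sub hhi) ?_
    filter_upwards [hs.ae_hasDerivAt hs0.le (hlt t), hdiff S.isLipschitz_freqRate,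
      hdiff S.isLipschitz_correction] with τ h1 h2 h3 hτ
    have hτ0 : 0 < τ := hs0.trans hτ.1
    have hτu : τ ∈ uIcc s t := by rw [uIcc_of_le hst]; exact ⟨hτ.1.le, hτ.2.le⟩
    obtain ⟨E', hE, hE'⟩ := exists_hasDerivAt_energy hd (h1 hτ)
    have hU := hasDerivAt_velocityEnergy (h1 hτ) (by
      filter_upwards [lt_mem_nhds hτ0] with r hr
      exact ⟨hmem r hr.le, hF r hr.le⟩) (fun i => h2 i hτu) (fun i => h3 i hτu)
    have hx : ∀ i, HasDerivAt (fun t => (S.Pmax i - S.Pmin i) * S.β i * e i t)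
        (-((S.Pmax i - S.Pmin i) * S.β i ^ 2 * e i τ)) τ := by
      intro i
      refine (((((hasDerivAt_id τ).const_mul (S.β i)).neg.exp).const_mul (κ i)).const_mul
        ((S.Pmax i - S.Pmin i) * S.β i)).congr_deriv ?_
      simp only [he, id, Pi.neg_apply]
      ring
    refine ⟨_, ((hE.const_mul g).add hU).add (HasDerivAt.fun_sum fun i _ => hx i), ?_⟩
    have h4 := mul_le_mul_of_nonneg_left hE' hg0.le
    refine (add_le_add_left (add_le_add_left h4 _) _).trans ?_
    rw [dissipation, Finset.mul_sum, Finset.mul_sum, ← Finset.sum_neg_distrib,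
      ← Finset.sum_add_distrib, ← Finset.sum_add_distrib, ← Finset.sum_sub_distrib]
    refine Finset.sum_le_sum fun i _ => ?_
    have h5 := (hspec i τ hτ0.le).2 g hg0.le (hi₀ i)
    have h6 := mul_nonneg (S.D_pos i).le (sq_nonneg (S.freqRate (z τ) i))
    have h7 := mul_nonneg (S.a_pos i).le (sq_nonneg (S.refRate (z τ) i))
    have hc : S.correction (z τ) i = S.generation (z τ) i - (z τ).genRef i := rfl
    rw [← hc]
    simp only [hh]
    linarith
  rw [intervalIntegral.integral_sub hdn hhi, intervalIntegral.integral_neg,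
    intervalIntegral.integral_finsetSum fun i _ => (hq i).1] at key
  have hsum := Finset.sum_le_sum fun i (_ : i ∈ Finset.univ) => (hq i).2
  rw [Finset.sum_sub_distrib] at hsum
  beta_reduce
  linarith

theorem IsSolution.continuousAt {T : EReal} (hs : S.IsSolution T z) {t : ℝ} (ht : 0 < t)
    (htT : (t : EReal) < T) : ContinuousAt z t := by
  obtain ⟨b, htb, hbT⟩ := EReal.lt_iff_exists_real_btwn.1 htT
  have htb' : t < b := by exact_mod_cast htb
  exact (hs.continuousOn le_rfl (ht.trans htb').le hbT).continuousAt (Icc_mem_nhds ht htb')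

/-- Feasible complete solutions are bounded, and their dissipated energy is finite. -/
theorem IsSolution.exists_bound_of_feasible (hd : ∀ i, S.Pmin i < S.d i ∧ S.d i < S.Pmax i)
    (hs : S.IsSolution ⊤ z) (hF : ∀ t, 0 ≤ t → S.SafetyFeasible (z t)) :
    ∃ s > 0, ∃ R Q : ℝ, ∀ t, s ≤ t → ‖z t‖ ≤ R ∧ ∫ τ in s..t, S.dissipation (z τ) ≤ Q := by
  have hlt : ∀ b : ℝ, (b : EReal) < ⊤ := EReal.coe_lt_top
  obtain ⟨g, hg, Λ, hΛ0, hΛ⟩ := hs.exists_lyapunov hd hF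
  -- The Lyapunov inequality is available only at such times; density and continuity extend its
  -- consequences to all later times.
  have hdense : Dense {t : ℝ | 0 ≤ t → HasDerivAt z (S.closedLoop (z t)) t} := by
    refine Measure.dense_of_ae (μ := volume) ?_
    filter_upwards [hs.deriv] with t ht h0
    exact ht h0 (hlt t)
  obtain ⟨s, hsg, hs0, -⟩ := hdense.exists_between (zero_lt_one (α := ℝ))
  have hds := hsg hs0.le
  obtain ⟨C, hC0, hC⟩ := S.exists_norm_sub_equilibrium_le
  have hint : ∀ a b, 0 ≤ a → a ≤ b →
      IntervalIntegrable (fun τ => S.dissipation (z τ)) volume a b := fun a b ha hab => by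
    refine ContinuousOn.intervalIntegrable ?_
    rw [uIcc_of_le hab]
    exact S.continuous_dissipation.comp_continuousOn (hs.continuousOn ha hab (hlt b))
  have hgood : ∀ t, s ≤ t → HasDerivAt z (S.closedLoop (z t)) t →
      g * S.energy (z t) ≤ Λ s ∧ ∫ τ in s..t, S.dissipation (z τ) ≤ Λ s / g := by
    intro t hst hdt
    have h1 := hΛ s t hs0 hst hds hdt
    have h2 := hΛ0 t (hs0.le.trans hst)
    have h3 : 0 ≤ ∫ τ in s..t, S.dissipation (z τ) :=
      intervalIntegral.integral_nonneg hst fun τ _ => dissipation_nonneg _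
    have h4 : 0 ≤ g * S.energy (z t) := mul_nonneg hg.le (energy_nonneg _)
    rw [intervalIntegral.integral_const_mul] at h1
    have h5 := mul_nonneg hg.le h3
    exact ⟨by linarith, by rw [le_div_iff₀ hg]; linarith⟩
  refine ⟨s, hs0, ‖S.equilibrium‖ + C * √(Λ s / g), Λ s / g, fun t hst => ⟨?_, ?_⟩⟩
  · have hE : S.energy (z t) ≤ Λ s / g := by
      by_contra hlt'
      rw [not_le] at hlt'
      have hcont : ContinuousAt (fun t => S.energy (z t)) t :=
        S.continuous_energy.continuousAt.comp (hs.continuousAt (hs0.trans_le hst) (hlt t))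
      obtain ⟨ε, hε, hball⟩ := Metric.eventually_nhds_iff.1 (hcont.eventually_const_lt hlt')
      obtain ⟨t', ht'g, h1, h2⟩ := hdense.exists_between (show t < t + ε by linarith)
      have h3 := hball (show dist t' t < ε by
        rw [Real.dist_eq, abs_of_nonneg (by linarith)]; linarith)
      have h4 := (hgood t' (hst.trans h1.le) (ht'g (hs0.le.trans (hst.trans h1.le)))).1
      rw [div_lt_iff₀ hg] at h3
      linarith
    have h1 := hC (z t)
    have h2 : √(S.energy (z t)) ≤ √(Λ s / g) := Real.sqrt_le_sqrt hE
    have h3 : ‖z t‖ ≤ ‖S.equilibrium‖ + ‖z t - S.equilibrium‖ := by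
      simpa using norm_add_le S.equilibrium (z t - S.equilibrium)
    have h4 := mul_le_mul_of_nonneg_left h2 hC0.le
    linarith
  · obtain ⟨t', ht'g, h1, -⟩ := hdense.exists_between (show t < t + 1 by linarith)
    have h2 := (hgood t' (hst.trans h1.le) (ht'g (hs0.le.trans (hst.trans h1.le)))).2
    have h3 := intervalIntegral.integral_add_adjacent_intervals (hint s t hs0.le hst)
      (hint t t' (hs0.le.trans hst) h1.le)
    have h4 : 0 ≤ ∫ τ in t..t', S.dissipation (z τ) :=
      intervalIntegral.integral_nonneg h1.le fun τ _ => dissipation_nonneg _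
    linarith

theorem tendsto_zero_of_mul_sq_le {f y : ℝ → ℝ} {c : ℝ} (hc : 0 < c)
    (h : ∀ᶠ t in atTop, c * f t ^ 2 ≤ y t) (hy : Tendsto y atTop (𝓝 0)) :
    Tendsto f atTop (𝓝 0) := by
  have h1 : Tendsto (fun t => √(y t / c)) atTop (𝓝 0) := by
    have := (hy.div_const c).sqrt
    simpa using this
  refine squeeze_zero_norm' ?_ h1
  filter_upwards [h] with t ht
  rw [Real.norm_eq_abs]
  refine Real.abs_le_sqrt ?_
  rw [le_div_iff₀ hc]
  linarith

theorem tendsto_angle_zero {α : ℝ → Fin n → ℝ}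
    (h : ∀ i, Tendsto (fun t => S.tiePower (α t) i) atTop (𝓝 0)) :
    Tendsto α atTop (𝓝 0) := by
  obtain ⟨K, -, hK⟩ := LinearMap.exists_antilipschitzWith (Matrix.mulVecLin
      (S.incidence * Matrix.diagonal S.B * S.reducedIncidence.transpose)) (by
    rw [LinearMap.ker_eq_bot']
    intro α hα
    exact S.eq_zero_of_tiePower_eq_zero fun i => congrFun hα i)
  have h1 : Tendsto (fun t => K * ‖S.tiePower (α t)‖) atTop (𝓝 0) := by
    have := (tendsto_pi_nhds.2 h).norm.const_mul (K : ℝ)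
    simpa using this
  refine squeeze_zero_norm (fun t => ?_) h1
  have := hK.le_mul_dist (α t) 0
  rwa [map_zero, dist_zero_right, dist_zero_right] at this

/-- Complete solutions along which the safety programs are feasible converge to the equilibrium. -/
theorem IsSolution.tendsto_equilibrium (hd : ∀ i, S.Pmin i < S.d i ∧ S.d i < S.Pmax i)
    (hs : S.IsSolution ⊤ z) (hF : ∀ t, 0 ≤ t → S.SafetyFeasible (z t)) :
    Tendsto z atTop (𝓝 S.equilibrium) := by
  have hlt : ∀ b : ℝ, (b : EReal) < ⊤ := EReal.coe_lt_top
  have hmem : ∀ t, 0 ≤ t → z t ∈ S.stateSet := fun t ht => hs.mem t ht (hlt t)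
  obtain ⟨s, hs0, R, Q, hb⟩ := hs.exists_bound_of_feasible hd hF
  obtain ⟨C, hC0, hC⟩ := S.exists_norm_closedLoop_le R
  have hL : LipschitzOnWith ⟨C, hC0⟩ z (Ici s) :=
    hs.lipschitzOnWith (Ici_subset_Ici.2 hs0.le) ordConnected_Ici (fun t _ => hlt t)
      fun t ht => hC _ (hb t ht).1
  have huc : ∀ {G : PowerState n → ℝ}, Continuous G →
      UniformContinuousOn (fun t => G (z t)) (Ici s) := fun hG =>
    ((isCompact_closedBall (0 : PowerState n) R).uniformContinuousOn_of_continuous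
      hG.continuousOn).comp hL.uniformContinuousOn fun t ht => by
        simpa using (hb t ht).1
  have hbar : ∀ {f G : PowerState n → ℝ} {l r : ℝ}, IsLipschitz f → Continuous G → s ≤ r →
      (∀ t, r < t → HasDerivAt z (S.closedLoop (z t)) t →
        HasDerivAt (fun t => f (z t)) (G (z t)) t) →
      Tendsto (fun t => f (z t)) atTop (𝓝 l) → Tendsto (fun t => G (z t)) atTop (𝓝 0) := by
    intro f G l r hf hG hr hder hl
    refine tendsto_zero_of_uniformContinuous_deriv (s := r) (fun a b ha hab =>
      hs.absCont_comp hf (hs0.le.trans (hr.trans ha)) hab (hlt b)) ?_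
      ((huc hG).mono (Ici_subset_Ici.2 hr)) hl
    filter_upwards [hs.deriv] with t ht hrt
    exact hder t hrt (ht (hs0.le.trans (hr.trans hrt.le)) (hlt t))
  have hdiss : Tendsto (fun t => S.dissipation (z t)) atTop (𝓝 0) := by
    -- Freezing the state before `s` makes `y` continuous on the line. Its primitive is monotone and
    -- bounded, hence convergent, and Barbalat's lemma applies.
    set y : ℝ → ℝ := fun t => S.dissipation (z (max s t)) with hy
    have hyc : Continuous y := by
      refine S.continuous_dissipation.comp (hL.continuousOn.comp_continuous (by fun_prop) ?_)
      exact fun t => le_max_left s t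
    have hy0 : ∀ t, 0 ≤ y t := fun t => dissipation_nonneg _
    have hyz : ∀ t, s ≤ t → y t = S.dissipation (z t) := fun t ht => by
      simp only [hy, max_eq_right ht]
    set F : ℝ → ℝ := fun t => ∫ τ in s..t, y τ with hFdef
    have hFd : ∀ t, HasDerivAt F (y t) t := fun t =>
      intervalIntegral.integral_hasDerivAt_right (hyc.intervalIntegrable _ _)
        (hyc.stronglyMeasurableAtFilter _ _) hyc.continuousAt
    have hFm : Monotone F := monotone_of_hasDerivAt_nonneg hFd hy0
    have hFb : BddAbove (range F) := by
      refine ⟨Q, ?_⟩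
      rintro _ ⟨t, rfl⟩
      refine (hFm (le_max_right s t)).trans ?_
      refine le_trans (le_of_eq ?_) (hb (max s t) (le_max_left _ _)).2
      refine intervalIntegral.integral_congr fun τ hτ => ?_
      rw [uIcc_of_le (le_max_left _ _)] at hτ
      exact hyz τ hτ.1
    have hFC : ContDiff ℝ 1 F := by
      rw [contDiff_one_iff_deriv]
      refine ⟨fun t => (hFd t).differentiableAt, ?_⟩
      rw [funext fun t => (hFd t).deriv]
      exact hyc
    have := tendsto_zero_of_uniformContinuous_deriv (F := F) (y := y) (s := s)
      (fun a b _ _ => hFC.contDiffOn.absolutelyContinuousOnInterval)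
      (Eventually.of_forall fun t _ => hFd t)
      ((huc S.continuous_dissipation).congr fun t ht => (hyz t ht).symm)
      (tendsto_atTop_ciSup hFm hFb)
    refine this.congr' ?_
    filter_upwards [eventually_ge_atTop s] with t ht
    exact hyz t ht
  have hterm : ∀ i t, S.D i * (z t).freq i ^ 2 + S.a i * ((z t).genRef i - S.d i) ^ 2 ≤
      S.dissipation (z t) := fun i t =>
    Finset.single_le_sum (fun i _ => dissipation_term_nonneg (S := S) (z t) i) (Finset.mem_univ i)
  have hw : ∀ i, Tendsto (fun t => (z t).freq i) atTop (𝓝 0) := fun i =>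
    tendsto_zero_of_mul_sq_le (S.D_pos i) (Eventually.of_forall fun t => by
      have := mul_nonneg (S.a_pos i).le (sq_nonneg ((z t).genRef i - S.d i))
      linarith [hterm i t]) hdiss
  have hp : ∀ i, Tendsto (fun t => (z t).genRef i - S.d i) atTop (𝓝 0) := fun i =>
    tendsto_zero_of_mul_sq_le (S.a_pos i) (Eventually.of_forall fun t => by
      have := mul_nonneg (S.D_pos i).le (sq_nonneg ((z t).freq i))
      linarith [hterm i t]) hdiss
  have hP : ∀ i, Tendsto (fun t => (z t).genRef i) atTop (𝓝 (S.d i)) := fun i => by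
    simpa using (hp i).add_const (S.d i)
  have hω : ∀ i, Tendsto (fun t => S.freqRate (z t) i) atTop (𝓝 0) := fun i =>
    hbar (isLipschitz_freq i) (S.isLipschitz_freqRate i).continuous le_rfl
      (fun t _ h => (hasDerivAt_coord h).2.1 i) (hw i)
  -- The references converge to interior points, so the projection is eventually inactive and the
  -- drive is their derivative.
  have hu : ∀ i, Tendsto (fun t => S.refDrive (z t) i) atTop (𝓝 0) := by
    intro i
    obtain ⟨r, hr⟩ := eventually_atTop.1 (((hP i).eventually_const_lt (hd i).1).and
      ((hP i).eventually_lt_const (hd i).2))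
    refine hbar (isLipschitz_genRef i) (S.isLipschitz_refDrive i).continuous (le_max_left s r)
      (fun t ht h => ?_) (hP i)
    have h1 := hr t ((le_max_right s r).trans ht.le)
    have h2 := (hasDerivAt_coord h).2.2.1 i
    rwa [refRate, projBox_of_mem_Ioo h1.1 h1.2] at h2
  have hξ : ∀ i, Tendsto (fun t => (z t).mult i) atTop (𝓝 (S.equilibrium.mult i)) := by
    intro i
    have := ((((hP i).const_mul (S.a i)).neg.sub_const (S.b i)).sub (hw i)).sub (hu i)
    rw [sub_zero, sub_zero] at this
    refine this.congr fun t => ?_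
    rw [refDrive]
    ring
  -- A nonzero correction would force ω = β (wmin - w) or ω = β (wmax - w), whereas ω and w tend to
  -- 0 and the bounds are nonzero.
  have hcorr : ∀ i, ∀ᶠ t in atTop, S.generation (z t) i = (z t).genRef i := by
    intro i
    have h1 : Tendsto (fun t => S.freqRate (z t) i - S.β i * (S.wmin i - (z t).freq i)) atTop
        (𝓝 (0 - S.β i * (S.wmin i - 0))) := (hω i).sub (((hw i).const_sub _).const_mul _)
    have h2 : Tendsto (fun t => S.freqRate (z t) i - S.β i * (S.wmax i - (z t).freq i)) atTop
        (𝓝 (0 - S.β i * (S.wmax i - 0))) := (hω i).sub (((hw i).const_sub _).const_mul _)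
    have h3 := h1.eventually_const_lt (u := 0) (by
      have := mul_neg_of_pos_of_neg (S.β_pos i) (S.wmin_neg i); linarith)
    have h4 := h2.eventually_lt_const (u := 0) (by
      have := mul_pos (S.β_pos i) (S.wmax_pos i); linarith)
    filter_upwards [h3, h4, eventually_ge_atTop 0] with t h5 h6 ht
    obtain ⟨-, h7, h8⟩ := S.freqRate_spec (hmem t ht) (hF t ht) i
    rcases lt_trichotomy (S.generation (z t) i) ((z t).genRef i) with h | h | h
    · linarith [h8 h]
    · exact h
    · linarith [h7 h]
  have hφ : ∀ i, Tendsto (fun t => S.tiePower (z t).angle i) atTop (𝓝 0) := by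
    intro i
    have := ((hp i).sub ((hw i).const_mul (S.D i))).sub ((hω i).const_mul (S.M i))
    rw [mul_zero, mul_zero, sub_zero, sub_zero] at this
    refine this.congr' ?_
    filter_upwards [hcorr i] with t ht
    rw [M_mul_freqRate, ht]
    ring
  exact (tendsto_angle_zero hφ).prodMk_nhds ((tendsto_pi_nhds.2 hw).prodMk_nhds
    ((tendsto_pi_nhds.2 hP).prodMk_nhds (tendsto_pi_nhds.2 hξ)))

end PowerSystem

end

namespace PowerSystem

open PowerState

variable {n m : ℕ} {S : PowerSystem n m}

/-! ### Stability -/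

/-- Near the equilibrium the generation references satisfy the barrier conditions. -/
theorem eventually_barrier : ∀ᶠ z in 𝓝 S.equilibrium, ∀ i,
    S.barrierLower z i < z.genRef i ∧ z.genRef i < S.barrierUpper z i := by
  refine eventually_all.2 fun i => ?_
  have ht : S.tiePower S.equilibrium.angle i = 0 := congrFun (Matrix.mulVec_zero _) i
  have hβ := mul_pos (S.β_pos i) (S.M_pos i)
  have h1 := mul_neg_of_pos_of_neg hβ (S.wmin_neg i)
  have h2 := mul_pos hβ (S.wmax_pos i)
  have e3 : S.equilibrium.genRef i = S.d i := rfl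
  refine ((S.isLipschitz_barrierLower i).continuous.continuousAt.eventually_lt
    (isLipschitz_genRef i).continuous.continuousAt ?_).and
    ((isLipschitz_genRef i).continuous.continuousAt.eventually_lt
    (S.isLipschitz_barrierUpper i).continuous.continuousAt ?_)
  · rw [barrierLower, ht, e3]
    simp [equilibrium, freq]
    linarith
  · rw [barrierUpper, ht, e3]
    simp [equilibrium, freq]
    linarith

theorem generation_eq_genRef {z : PowerState n} (hz : z ∈ S.stateSet) {i : Fin (n + 1)}
    (h : S.barrierLower z i < z.genRef i ∧ z.genRef i < S.barrierUpper z i) :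
    S.generation z i = z.genRef i := by
  have := hz i
  unfold generation
  grind

theorem isStable_equilibrium (hd : ∀ i, S.Pmin i < S.d i ∧ S.d i < S.Pmax i) :
    S.IsStable S.equilibrium := by
  intro U hU
  obtain ⟨r, hr, hball⟩ := Metric.mem_nhds_iff.1 (inter_mem hU (eventually_barrier (S := S)))
  obtain ⟨C, hC0, hC⟩ := S.exists_norm_sub_equilibrium_le
  have hV : {z | S.energy z < (r / C) ^ 2} ∈ 𝓝 S.equilibrium := by
    refine S.continuous_energy.continuousAt.eventually_lt_const ?_
    rw [energy_equilibrium]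
    positivity
  have hnear : ∀ z, S.energy z < (r / C) ^ 2 → dist z S.equilibrium < r := by
    intro z hz
    rw [dist_eq_norm]
    refine (hC z).trans_lt ?_
    have : √(S.energy z) < r / C := (Real.sqrt_lt' (by positivity)).2 hz
    rw [lt_div_iff₀ hC0] at this
    linarith
  refine ⟨_, hV, fun T z hs hz0 t ht htT => (hball ?_).1⟩
  by_contra hcon
  rw [Metric.mem_ball, not_lt] at hcon
  have hcont : ContinuousOn (fun τ => dist (z τ) S.equilibrium) (Icc 0 t) :=
    (continuous_id.dist continuous_const).comp_continuousOn (hs.continuousOn le_rfl ht htT)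
  have hclosed : IsClosed (Icc 0 t ∩ (fun τ => dist (z τ) S.equilibrium) ⁻¹' Ici r) :=
    hcont.preimage_isClosed_of_isClosed isClosed_Icc isClosed_Ici
  -- At the first exit time from the ball the energy is still at most its initial value, since no
  -- correction acts inside the ball; but that sublevel set lies in the ball.
  obtain ⟨t₁, ⟨ht₁, hrt₁⟩, hleast⟩ := (isCompact_Icc.of_isClosed_subset hclosed
    inter_subset_left).exists_isLeast ⟨t, ⟨ht, le_rfl⟩, hcon⟩
  have ht₁T : (t₁ : EReal) < T := (EReal.coe_le_coe_iff.2 ht₁.2).trans_lt htT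
  have hdec : S.energy (z t₁) ≤ S.energy (z 0) := by
    refine (hs.absCont_energy le_rfl ht₁.1 ht₁T).le_of_deriv_nonpos ht₁.1 ?_
    filter_upwards [hs.ae_hasDerivAt le_rfl ht₁T] with τ h hτ
    obtain ⟨E', hE, hE'⟩ := exists_hasDerivAt_energy hd (h hτ)
    refine ⟨E', hE, hE'.trans (Finset.sum_nonpos fun i _ => ?_)⟩
    have hτT : (τ : EReal) < T := (EReal.coe_lt_coe_iff.2 hτ.2).trans ht₁T
    have hτr : z τ ∈ Metric.ball S.equilibrium r := by
      by_contra hτr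
      rw [Metric.mem_ball, not_lt] at hτr
      exact absurd (hleast ⟨⟨hτ.1.le, hτ.2.le.trans ht₁.2⟩, hτr⟩) (not_le.2 hτ.2)
    rw [generation_eq_genRef (hs.mem τ hτ.1.le hτT) ((hball hτr).2 i)]
    have h1 := mul_nonneg (S.D_pos i).le (sq_nonneg ((z τ).freq i))
    have h2 := mul_nonneg (S.a_pos i).le (sq_nonneg ((z τ).genRef i - S.d i))
    linarith
  exact absurd (hnear _ (hdec.trans_lt hz0)) (not_lt.2 hrt₁)

/-- Stability confines the solution to states where the reference itself is feasible, so the global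
result for feasible solutions applies. -/
theorem isAttractive_equilibrium (hd : ∀ i, S.Pmin i < S.d i ∧ S.d i < S.Pmax i) :
    S.IsAttractive S.equilibrium := by
  obtain ⟨V, hV, h⟩ := isStable_equilibrium hd _ (eventually_barrier (S := S))
  refine ⟨V, hV, fun T z hs hz0 => ?_⟩
  have hF : ∀ t : ℝ, 0 ≤ t → (t : EReal) < T → S.SafetyFeasible (z t) := fun t ht htT i =>
    ⟨(z t).genRef i, hs.1.mem t ht htT i, (h T z hs.1 hz0 t ht htT i).1.le,
      (h T z hs.1 hz0 t ht htT i).2.le⟩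
  have hT := hs.eq_top_of_feasible (fun i => (hd i).1.trans (hd i).2) hF
  subst hT
  exact ⟨rfl, hs.1.tendsto_equilibrium hd fun t ht => hF t ht (EReal.coe_lt_top t)⟩

end PowerSystem

theorem mainTheorem1 {n m : ℕ} (S : PowerSystem n m)
    (hd : ∀ i, S.Pmin i < S.d i ∧ S.d i < S.Pmax i) :
    ∃ ze : PowerState n,
      (S.IsEquilibrium ze ∧ ∀ z, S.IsEquilibrium z → z = ze) ∧
      S.IsAsymptoticallyStable ze ∧
      ∀ (T : EReal) (z : ℝ → PowerState n), S.IsMaximalSolution T z →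
        (∀ t : ℝ, 0 ≤ t → (t : EReal) < T → S.SafetyFeasible (z t)) →
          T = ⊤ ∧ Tendsto z atTop (𝓝 ze) := by
  refine ⟨S.equilibrium, ⟨(PowerSystem.isEquilibrium_iff hd _).2 rfl, fun z hz =>
    (PowerSystem.isEquilibrium_iff hd z).1 hz⟩, ⟨PowerSystem.isStable_equilibrium hd,
    PowerSystem.isAttractive_equilibrium hd⟩, fun T z hs hF => ?_⟩
  have hT := hs.eq_top_of_feasible (fun i => (hd i).1.trans (hd i).2) hF
  subst hT
  exact ⟨rfl, hs.1.tendsto_equilibrium hd fun t ht => hF t ht (EReal.coe_lt_top t)⟩
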